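/- **Theorem (Ladder case).** Let $L\ge 1$ be an integer, let $\Lambda=\{(r_1,r_2)\in\mathbb Z^2: 1\le r_1\le L,\ 1\le r_2\le 2\}$ be the two-leg ladder, with $r_1$ read modulo $L$ (periodic boundary condition along the legs, open boundary condition in the rung direction), and let $\vec e_1=(1,0)$. On $\bigotimes_{\vec r\in\Lambda}\mathbb C^2$ consider the quantum Ising Hamiltonian $$H=\sum_{\vec r\in\Lambda}\bigl(J^1 Z_{\vec r}Z_{\vec r+\vec e_1}+h^xX_{\vec r}+h^zZ_{\vec r}\bigr)+\sum_{r_1=1}^{L}J^2Z_{(r_1,1)}Z_{(r_1,2)},$$ where $X_{\vec r},Y_{\vec r},Z_{\vec r}$ are the Pauli operators on site $\vec r$, with real couplings $J^1,J^2,h^x\neq 0$ and arbitrary real $h^z$. A Pauli product $\bigotimes_{\vec p\in\Lambda}A_{\vec p}$, with $A_{\vec p}\in\{I,X,Y,Z\}$, is supported on the sites where $A_{\vec p}\ne I$. It is an $(\ell_1,\ell_2)$-support operator if the smallest rectangle $\{r_1,\dots,r_1+\ell_1-1\}\times\{r_2,\dots,r_2+\ell_2-1\}$ (first coordinate modulo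 $L$) containing its support has side lengths $\ell_1,\ell_2$, with side lengths $0,0$ for the identity. An operator $Q$ commuting with $H$ is a $(k_1,k_2)$-local conserved quantity if the maximum values of $\ell_1$ and of $\ell_2$ over the Pauli products with nonzero coefficient in the expansion of $Q$ are exactly $k_1$ and $k_2$, respectively. It is a $k$-local conserved quantity if it is a $(k,2)$-local or a $(k,1)$-local conserved quantity. Let $k$ be a positive integer with $k\le L/2$. 1. If $3\le k\le L/2$, the model has no $k$-local conserved quantity. 2. If $k\le 2$, every $k$-local conserved quantity is a linear combination of $H$ and the identity $I$, with complex coefficients, and it is a $2$-local conserved quantity. -/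

import Mathlib

namespace IsingLadder

/-- Sites `(r₁, r₂)` of the two-leg ladder of length `L`: the coordinate `r₁` along the legs is
periodic, and `r₂ : Fin 2` labels the two legs. -/
abbrev Site (L : ℕ) : Type := ZMod L × Fin 2

/-- The translation `r ↦ r + e₁` along the legs, with the periodic boundary condition. -/
def Site.next {L : ℕ} (r : Site L) : Site L := (r.1 + 1, r.2)

/-- Labels of the single-site Pauli operators. -/
inductive Pauli : Type
  | I | X | Y | Z
  deriving DecidableEq

instance : Fintype Pauli :=
  ⟨{Pauli.I, Pauli.X, Pauli.Y, Pauli.Z}, fun P => by cases P <;> simp⟩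

/-- The `2 × 2` matrix of a Pauli operator. -/
def Pauli.matrix : Pauli → Matrix (Fin 2) (Fin 2) ℂ
  | Pauli.I => 1
  | Pauli.X => !![0, 1; 1, 0]
  | Pauli.Y => !![0, -Complex.I; Complex.I, 0]
  | Pauli.Z => !![1, 0; 0, -1]

/-- Operators on the Hilbert space `⨂_{r} ℂ²` of the spins on the ladder, written as matrices in
the product basis, which is indexed by the configurations `Site L → Fin 2`. -/
abbrev Operator (L : ℕ) : Type := Matrix (Site L → Fin 2) (Site L → Fin 2) ℂ

section

variable {L : ℕ} [NeZero L]

/-- The Pauli product `⨂_p A_p`. -/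
def pauliProduct (A : Site L → Pauli) : Operator L :=
  Matrix.of fun s t => ∏ p, (A p).matrix (s p) (t p)

/-- The Pauli operator `P` on the site `r` (with the identity on every other site). -/
def siteOp (P : Pauli) (r : Site L) : Operator L :=
  pauliProduct (Function.update (fun _ => Pauli.I) r P)

/-- The Hamiltonian of the quantum Ising ladder, periodic along the legs and open in the rung
direction. -/
def hamiltonian (L : ℕ) [NeZero L] (J₁ J₂ hx hz : ℝ) : Operator L :=
  ∑ r : Site L,
      ((J₁ : ℂ) • (siteOp Pauli.Z r * siteOp Pauli.Z r.next)
        + (hx : ℂ) • siteOp Pauli.X r + (hz : ℂ) • siteOp Pauli.Z r)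
    + ∑ r₁ : ZMod L, (J₂ : ℂ) • (siteOp Pauli.Z (r₁, 0) * siteOp Pauli.Z (r₁, 1))

end

/-- The support of a Pauli product: the sites on which it acts nontrivially. -/
def support {L : ℕ} (A : Site L → Pauli) : Set (Site L) := {p | A p ≠ Pauli.I}

/-- The rectangle with corner `r` and side lengths `ℓ₁`, `ℓ₂`; it may wrap around in the periodic
direction along the legs. -/
def rectangle {L : ℕ} (r : Site L) (ℓ₁ ℓ₂ : ℕ) : Set (Site L) :=
  {p | (∃ i < ℓ₁, p.1 = r.1 + (i : ZMod L)) ∧ ∃ j < ℓ₂, (p.2 : ℕ) = (r.2 : ℕ) + j}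

/-- The side length along the legs of the smallest rectangle containing the support of `A`
(`0` if the support is empty). -/
noncomputable def suppLength₁ {L : ℕ} (A : Site L → Pauli) : ℕ :=
  sInf {ℓ₁ | ∃ (r : Site L) (ℓ₂ : ℕ), support A ⊆ rectangle r ℓ₁ ℓ₂}

/-- The side length in the rung direction of the smallest rectangle containing the support of `A`
(`0` if the support is empty). -/
noncomputable def suppLength₂ {L : ℕ} (A : Site L → Pauli) : ℕ :=
  sInf {ℓ₂ | ∃ (r : Site L) (ℓ₁ : ℕ), support A ⊆ rectangle r ℓ₁ ℓ₂}

/-- `Q` is a `(k₁, k₂)`-local conserved quantity of the Hamiltonian `H`: it commutes with `H`, and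
in its expansion in Pauli products the maximum values of the side lengths `ℓ₁`, `ℓ₂` of the
supports that appear (with nonzero coefficient) are `k₁` and `k₂`. -/
def IsRectLocalConserved {L : ℕ} [NeZero L] (H : Operator L) (k₁ k₂ : ℕ) (Q : Operator L) : Prop :=
  Commute Q H ∧
    ∃ c : (Site L → Pauli) → ℂ,
      Q = ∑ A, c A • pauliProduct A ∧
      IsGreatest {ℓ₁ | ∃ A, c A ≠ 0 ∧ suppLength₁ A = ℓ₁} k₁ ∧
      IsGreatest {ℓ₂ | ∃ A, c A ≠ 0 ∧ suppLength₂ A = ℓ₂} k₂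

/-- `Q` is a `k`-local conserved quantity of the ladder Hamiltonian `H`. -/
def IsLocalConserved {L : ℕ} [NeZero L] (H : Operator L) (k : ℕ) (Q : Operator L) : Prop :=
  IsRectLocalConserved H k 2 Q ∨ IsRectLocalConserved H k 1 Q

end IsingLadder

namespace IsingLadder

/-! Up to phases a Pauli product is a vector over `ZMod 2`, and commuting with `H` becomes a linear
system (`IsSolution`): for each string `B`, the sum of `weight h * D (B + h)` over the terms `h`
anticommuting with `B` vanishes. Since `2 * k ≤ L`, coefficients of range `k ≥ 2` lift to the
infinite ladder (`IsSolution.unwrap`), where strings have two ends.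

On each leg the terms `X_c` and `Z_c Z_{c+1}` form a chain in which neighbours anticommute and all
other pairs commute. They are numbered `2c` and `2c + 1`, and the length of a string is measured in
this order rather than in columns. Only these generators can shorten a string at an end; the rung
coupling and the longitudinal field have length `-1` and do not enter at leading order.

Let `n` be the maximal length. Extending a maximal string at the top gives an equation in which only
shortening at the bottom can cancel it, so the string slides upwards (`IsMaximal.slide`). After
enough slides nothing of the original is left, which forces it to be a product of consecutive
generators on one leg (`IsMaximal.eq_line`). Such products are fermion bilinears, and a single
transverse-field Ising chain does conserve combinations of them, so the leading order cannot
suffice. The rung coupling excludes them: insert `ZZ` on the rung of column `c` into a line of `n ≥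
2` generators and let the line pass over `c`. The `n` positions give `n` equations
(`defect_relation`) in only `n - 1` amplitudes of shorter lines with a defect; eliminating these
leaves `n * J₂ * D(line) = 0` (`recurrence_boundary`). Hence the length drops to one
(`LengthLE.one`).

At length one only the identity and the strings of `H` remain, and the equations make their
coefficients proportional to those of `H`, the rungs linking the two legs
(`LengthLE.eq_smul_coeff`). Range `k = 1` is excluded directly on the ring
(`IsSolution.eq_zero_of_one_column`). -/

/-- The pair `(x, z)` of exponents of the operator `X ^ x * Z ^ z` on one site. -/
abbrev PauliExponents : Type := ZMod 2 × ZMod 2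

/-- Pauli products on the ladder with columns indexed by `C`, up to a phase: the exponents of `X`
and `Z` on every site. -/
abbrev PauliString (C : Type*) : Type _ := (C × Fin 2) →₀ PauliExponents

/-- Labels of the terms of the Hamiltonian: the couplings along the legs and along the rungs, the
longitudinal field, and the transverse field. -/
inductive Term (C : Type*) : Type _
  | bond (r : C × Fin 2)
  | rung (c : C)
  | field (r : C × Fin 2)
  | flip (r : C × Fin 2)

/-- The couplings of the Hamiltonian. -/
structure Couplings : Type where
  J₁ : ℂ
  J₂ : ℂ
  hx : ℂ
  hz : ℂ

/-- The single-site string `Z` at `r`. -/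
noncomputable def zString {C : Type*} (r : C × Fin 2) : PauliString C :=
  Finsupp.single r (0, 1)

/-- The single-site string `X` at `r`. -/
noncomputable def xString {C : Type*} (r : C × Fin 2) : PauliString C :=
  Finsupp.single r (1, 0)

/-! ### Strings as vectors over `ZMod 2`, and the commutation equations. -/

section StringLemmas

variable {C : Type*}

lemma string_add_self (A : PauliString C) : A + A = 0 := by
  ext r <;> simp [CharTwo.add_self_eq_zero]

lemma string_add_cancel (A B : PauliString C) : A + B + B = A := by
  rw [add_assoc, string_add_self, add_zero]

variable [DecidableEq C]

@[simp] lemma zString_fst (r s : C × Fin 2) : (zString r s).1 = 0 := by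
  unfold zString; rw [Finsupp.single_apply]; split_ifs <;> rfl

@[simp] lemma zString_snd (r s : C × Fin 2) : (zString r s).2 = if r = s then 1 else 0 := by
  unfold zString; rw [Finsupp.single_apply]; split_ifs <;> rfl

@[simp] lemma xString_fst (r s : C × Fin 2) : (xString r s).1 = if r = s then 1 else 0 := by
  unfold xString; rw [Finsupp.single_apply]; split_ifs <;> rfl

@[simp] lemma xString_snd (r s : C × Fin 2) : (xString r s).2 = 0 := by
  unfold xString; rw [Finsupp.single_apply]; split_ifs <;> rfl

end StringLemmas

namespace Term

variable {C : Type*} [Add C] [One C]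

/-- The Pauli string of a term of the Hamiltonian. -/
noncomputable def string : Term C → PauliString C
  | bond r => zString r + zString (r.1 + 1, r.2)
  | rung c => zString (c, 0) + zString (c, 1)
  | field r => zString r
  | flip r => xString r

/-- The commutation form: it vanishes iff the term commutes with the string `B`. -/
def form : Term C → PauliString C → ZMod 2
  | bond r, B => (B r).1 + (B (r.1 + 1, r.2)).1
  | rung c, B => (B (c, 0)).1 + (B (c, 1)).1
  | field r, B => (B r).1
  | flip r, B => (B r).2

/-- The coefficient of a term in the Hamiltonian. -/
def coeff (g : Couplings) : Term C → ℂ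
  | bond _ => g.J₁
  | rung _ => g.J₂
  | field _ => g.hz
  | flip _ => g.hx

/-- The coefficient of a term in the commutation equations: the sign of the transverse field is
reversed. -/
def weight (g : Couplings) : Term C → ℂ
  | bond _ => g.J₁
  | rung _ => g.J₂
  | field _ => g.hz
  | flip _ => -g.hx

lemma form_add (h : Term C) (A B : PauliString C) : h.form (A + B) = h.form A + h.form B := by
  cases h <;> simp [form] <;> ring

lemma form_string_self (h : Term C) : h.form h.string = 0 := by
  classical
  cases h <;> simp [form, string]

lemma form_add_string (h : Term C) (A : PauliString C) : h.form (A + h.string) = h.form A := by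
  rw [form_add, form_string_self, add_zero]

end Term

/-- The summand of the commutation equation at the string `B` that belongs to the term `h`. -/
noncomputable def contribution {C : Type*} [Add C] [One C] (g : Couplings)
    (D : PauliString C → ℂ) (B : PauliString C) (h : Term C) : ℂ :=
  if h.form B = 0 then 0 else h.weight g * D (B + h.string)

/-- The coefficients `D` of an operator satisfy the equations which express that the operator
commutes with the Hamiltonian. -/
def IsSolution {C : Type*} [Add C] [One C] (g : Couplings) (D : PauliString C → ℂ) : Prop :=
  ∀ B, ∑ᶠ h, contribution g D B h = 0

lemma contribution_ne_zero {C : Type*} [Add C] [One C] {g : Couplings}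
    {D : PauliString C → ℂ} {B : PauliString C} {h : Term C} (H : contribution g D B h ≠ 0) :
    h.form B ≠ 0 ∧ D (B + h.string) ≠ 0 := by
  unfold contribution at H
  split_ifs at H with h0
  · exact absurd rfl H
  · exact ⟨h0, right_ne_zero_of_mul H⟩

lemma contribution_eq {C : Type*} [Add C] [One C] {g : Couplings}
    {D : PauliString C → ℂ} {B : PauliString C} {h : Term C} (H : h.form B ≠ 0) :
    contribution g D B h = h.weight g * D (B + h.string) := by
  rw [contribution, if_neg H]

/-! ### The two ends of a string in the order of the generators. -/

/-- `p` is a lower bound of the string `B` in the order `X_c, Z_c Z_{c+1}, X_{c+1}, …` of the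
elementary generators. -/
def LowerBdd (B : PauliString ℤ) (p : ℤ) : Prop :=
  ∀ r, ((B r).1 ≠ 0 → p ≤ 2 * r.1) ∧ ((B r).2 ≠ 0 → p ≤ 2 * r.1 + 1)

/-- `q` is an upper bound of the string `B` in the order `X_c, Z_c Z_{c+1}, X_{c+1}, …` of the
elementary generators. -/
def UpperBdd (B : PauliString ℤ) (q : ℤ) : Prop :=
  ∀ r, ((B r).1 ≠ 0 → 2 * r.1 + 1 ≤ q) ∧ ((B r).2 ≠ 0 → 2 * r.1 ≤ q)

lemma add_ne_zero_or {M : Type*} [AddZeroClass M] {a b : M} (h : a + b ≠ 0) : a ≠ 0 ∨ b ≠ 0 := by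
  by_contra! H
  exact h (by rw [H.1, H.2, add_zero])

lemma LowerBdd.add {A B : PauliString ℤ} {p : ℤ} (hA : LowerBdd A p) (hB : LowerBdd B p) :
    LowerBdd (A + B) p := by
  intro r
  refine ⟨fun h => ?_, fun h => ?_⟩
  · rcases add_ne_zero_or (a := (A r).1) (b := (B r).1) h with h | h
    exacts [(hA r).1 h, (hB r).1 h]
  · rcases add_ne_zero_or (a := (A r).2) (b := (B r).2) h with h | h
    exacts [(hA r).2 h, (hB r).2 h]

lemma UpperBdd.add {A B : PauliString ℤ} {p : ℤ} (hA : UpperBdd A p) (hB : UpperBdd B p) :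
    UpperBdd (A + B) p := by
  intro r
  refine ⟨fun h => ?_, fun h => ?_⟩
  · rcases add_ne_zero_or (a := (A r).1) (b := (B r).1) h with h | h
    exacts [(hA r).1 h, (hB r).1 h]
  · rcases add_ne_zero_or (a := (A r).2) (b := (B r).2) h with h | h
    exacts [(hA r).2 h, (hB r).2 h]

lemma LowerBdd.of_add {A B : PauliString ℤ} {p : ℤ} (hAB : LowerBdd (A + B) p)
    (hB : LowerBdd B p) : LowerBdd A p := by
  have := hAB.add hB
  rwa [string_add_cancel] at this

lemma UpperBdd.of_add {A B : PauliString ℤ} {p : ℤ} (hAB : UpperBdd (A + B) p)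
    (hB : UpperBdd B p) : UpperBdd A p := by
  have := hAB.add hB
  rwa [string_add_cancel] at this

lemma LowerBdd.mono {A : PauliString ℤ} {p p' : ℤ} (hA : LowerBdd A p) (h : p' ≤ p) :
    LowerBdd A p' :=
  fun r => ⟨fun H => h.trans ((hA r).1 H), fun H => h.trans ((hA r).2 H)⟩

lemma UpperBdd.mono {A : PauliString ℤ} {p p' : ℤ} (hA : UpperBdd A p) (h : p ≤ p') :
    UpperBdd A p' :=
  fun r => ⟨fun H => ((hA r).1 H).trans h, fun H => ((hA r).2 H).trans h⟩

lemma LowerBdd.zero (p : ℤ) : LowerBdd 0 p := fun r => by simp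

lemma UpperBdd.zero (p : ℤ) : UpperBdd 0 p := fun r => by simp

/-! ### The chain of generators and its action on the ends of a string. -/

/-- The `p`-th elementary generator on leg `j`: the transverse field for even `p` and the coupling
along the leg for odd `p`. -/
def generator (p : ℤ) (j : Fin 2) : Term ℤ :=
  if p % 2 = 0 then Term.flip (p / 2, j) else Term.bond (p / 2, j)

lemma generator_even (c : ℤ) (j : Fin 2) : generator (2 * c) j = Term.flip (c, j) := by
  rw [generator, if_pos (by lia)]; congr 2; lia

lemma generator_odd (c : ℤ) (j : Fin 2) : generator (2 * c + 1) j = Term.bond (c, j) := by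
  rw [generator, if_neg (by lia)]; congr 2; lia

lemma int_eq_two_mul_or (p : ℤ) : ∃ c, p = 2 * c ∨ p = 2 * c + 1 := Int.even_or_odd' p

lemma lowerBdd_generator (p : ℤ) (j : Fin 2) : LowerBdd (generator p j).string p := by
  obtain ⟨c, rfl | rfl⟩ := int_eq_two_mul_or p <;> rintro ⟨d, l⟩
  · rw [generator_even]
    simp [Term.string]; lia
  · rw [generator_odd]
    simp only [Term.string, Finsupp.add_apply, Prod.fst_add, Prod.snd_add, zString_fst,
      zString_snd, Prod.mk.injEq]
    refine ⟨by simp, fun h => ?_⟩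
    by_contra H
    exact h (by rw [if_neg (by lia), if_neg (by lia), add_zero])

lemma upperBdd_generator (p : ℤ) (j : Fin 2) : UpperBdd (generator p j).string (p + 1) := by
  obtain ⟨c, rfl | rfl⟩ := int_eq_two_mul_or p <;> rintro ⟨d, l⟩
  · rw [generator_even]
    simp [Term.string]; lia
  · rw [generator_odd]
    simp only [Term.string, Finsupp.add_apply, Prod.fst_add, Prod.snd_add, zString_fst,
      zString_snd, Prod.mk.injEq]
    refine ⟨by simp, fun h => ?_⟩
    by_contra H
    exact h (by rw [if_neg (by lia), if_neg (by lia), add_zero])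

lemma exists_fst_of_not_lowerBdd {B : PauliString ℤ} {c : ℤ} (hB : LowerBdd B (2 * c))
    (hB' : ¬ LowerBdd B (2 * c + 1)) : ∃ j, (B (c, j)).1 ≠ 0 := by
  by_contra! H
  refine hB' fun ⟨d, j⟩ => ⟨fun h => ?_, fun h => ?_⟩
  · have := (hB (d, j)).1 h
    have hd : d ≠ c := by rintro rfl; exact h (H j)
    simp only at *; lia
  · have := (hB (d, j)).2 h
    simp only at *; lia

lemma exists_snd_of_not_lowerBdd {B : PauliString ℤ} {c : ℤ} (hB : LowerBdd B (2 * c + 1))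
    (hB' : ¬ LowerBdd B (2 * c + 1 + 1)) : ∃ j, (B (c, j)).2 ≠ 0 := by
  by_contra! H
  refine hB' fun ⟨d, j⟩ => ⟨fun h => ?_, fun h => ?_⟩
  · have := (hB (d, j)).1 h
    simp only at *; lia
  · have := (hB (d, j)).2 h
    have hd : d ≠ c := by rintro rfl; exact h (H j)
    simp only at *; lia

lemma exists_fst_of_not_upperBdd {B : PauliString ℤ} {c : ℤ} (hB : UpperBdd B (2 * c + 1))
    (hB' : ¬ UpperBdd B (2 * c)) : ∃ j, (B (c, j)).1 ≠ 0 := by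
  by_contra! H
  refine hB' fun ⟨d, j⟩ => ⟨fun h => ?_, fun h => ?_⟩
  · have := (hB (d, j)).1 h
    have hd : d ≠ c := by rintro rfl; exact h (H j)
    simp only at *; lia
  · have := (hB (d, j)).2 h
    simp only at *; lia

lemma exists_snd_of_not_upperBdd {B : PauliString ℤ} {c : ℤ} (hB : UpperBdd B (2 * c))
    (hB' : ¬ UpperBdd B (2 * c - 1)) : ∃ j, (B (c, j)).2 ≠ 0 := by
  by_contra! H
  refine hB' fun ⟨d, j⟩ => ⟨fun h => ?_, fun h => ?_⟩
  · have := (hB (d, j)).1 h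
    simp only at *; lia
  · have := (hB (d, j)).2 h
    have hd : d ≠ c := by rintro rfl; exact h (H j)
    simp only at *; lia

lemma LowerBdd.fst_eq_zero {B : PauliString ℤ} {p : ℤ} (hB : LowerBdd B p) {c : ℤ} (h : 2 * c < p)
    (j : Fin 2) : (B (c, j)).1 = 0 := by
  by_contra H
  have := (hB (c, j)).1 H
  simp only at this; lia

lemma LowerBdd.snd_eq_zero {B : PauliString ℤ} {p : ℤ} (hB : LowerBdd B p) {c : ℤ}
    (h : 2 * c + 1 < p) (j : Fin 2) : (B (c, j)).2 = 0 := by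
  by_contra H
  have := (hB (c, j)).2 H
  simp only at this; lia

lemma UpperBdd.fst_eq_zero {B : PauliString ℤ} {q : ℤ} (hB : UpperBdd B q) {c : ℤ}
    (h : q < 2 * c + 1) (j : Fin 2) : (B (c, j)).1 = 0 := by
  by_contra H
  have := (hB (c, j)).1 H
  simp only at this; lia

lemma UpperBdd.snd_eq_zero {B : PauliString ℤ} {q : ℤ} (hB : UpperBdd B q) {c : ℤ}
    (h : q < 2 * c) (j : Fin 2) : (B (c, j)).2 = 0 := by
  by_contra H
  have := (hB (c, j)).2 H
  simp only at this; lia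

/-- Only a generator can raise the lower end of a string. -/
lemma eq_generator_of_lowerBdd {B : PauliString ℤ} {p : ℤ} {h : Term ℤ} (hB : LowerBdd B p)
    (hB' : ¬ LowerBdd B (p + 1)) (hf : h.form B ≠ 0) (hh : LowerBdd (B + h.string) (p + 1)) :
    ∃ j, h = generator p j := by
  obtain ⟨c, rfl | rfl⟩ := int_eq_two_mul_or p
  · obtain ⟨j, hj⟩ := exists_fst_of_not_lowerBdd hB hB'
    have h1 := hh.fst_eq_zero (c := c) (by lia) j
    have h2 : (h.string (c, j)).1 ≠ 0 := fun H => hj (by simpa [H] using h1)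
    refine ⟨j, ?_⟩
    rw [generator_even]
    cases h <;> simp [Term.string] at h2 ⊢
    exact h2
  · obtain ⟨j, hj⟩ := exists_snd_of_not_lowerBdd hB hB'
    have h1 := hh.snd_eq_zero (c := c) (by lia) j
    have h2 : (h.string (c, j)).2 ≠ 0 := fun H => hj (by simpa [H] using h1)
    -- There is no `X` part in columns up to `c`, so the fields and rungs of column `c` and the
    -- bonds ending there commute with `B`. Only a bond starting in column `c` is left.
    have hx : ∀ l, ∀ d ≤ c, (B (d, l)).1 = 0 := fun l d hd => hB.fst_eq_zero (by lia) l
    refine ⟨j, ?_⟩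
    rw [generator_odd]
    cases h with
    | bond r =>
      obtain ⟨d, l⟩ := r
      simp only [Term.string, Finsupp.add_apply, Prod.snd_add, zString_snd, Prod.mk.injEq] at h2
      by_cases hd : d = c ∧ l = j
      · rw [hd.1, hd.2]
      · rw [if_neg hd, zero_add] at h2
        have : d + 1 = c := by
          by_contra H
          exact h2 (if_neg fun H' => H H'.1)
        refine absurd ?_ hf
        simp [Term.form, hx _ d (by lia), hx _ (d + 1) (by lia)]
    | rung d =>
      have : d = c := by
        by_contra H
        simp [Term.string, H] at h2
      exact absurd (by simp [Term.form, hx _ d this.le]) hf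
    | field r =>
      have : r = (c, j) := by
        by_contra H
        simp [Term.string, H] at h2
      exact absurd (by simp [Term.form, this, hx _ c le_rfl]) hf
    | flip r => simp [Term.string] at h2

/-- Only a generator can lower the upper end of a string. -/
lemma eq_generator_of_upperBdd {B : PauliString ℤ} {q : ℤ} {h : Term ℤ} (hB : UpperBdd B (q + 1))
    (hB' : ¬ UpperBdd B q) (hf : h.form B ≠ 0) (hh : UpperBdd (B + h.string) q) :
    ∃ j, h = generator q j := by
  obtain ⟨c, rfl | rfl⟩ := int_eq_two_mul_or q
  · obtain ⟨j, hj⟩ := exists_fst_of_not_upperBdd hB hB'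
    have h1 := hh.fst_eq_zero (c := c) (by lia) j
    have h2 : (h.string (c, j)).1 ≠ 0 := fun H => hj (by simpa [H] using h1)
    refine ⟨j, ?_⟩
    rw [generator_even]
    cases h <;> simp [Term.string] at h2 ⊢
    exact h2
  · obtain ⟨j, hj⟩ := exists_snd_of_not_upperBdd (c := c + 1)
      (hB.mono (by lia)) (fun H => hB' (H.mono (by lia)))
    have h1 := hh.snd_eq_zero (c := c + 1) (by lia) j
    have h2 : (h.string (c + 1, j)).2 ≠ 0 := fun H => hj (by simpa [H] using h1)
    have hx : ∀ l, ∀ d, c + 1 ≤ d → (B (d, l)).1 = 0 := fun l d hd => hB.fst_eq_zero (by lia) l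
    refine ⟨j, ?_⟩
    rw [generator_odd]
    cases h with
    | bond r =>
      obtain ⟨d, l⟩ := r
      simp only [Term.string, Finsupp.add_apply, Prod.snd_add, zString_snd, Prod.mk.injEq] at h2
      by_cases hd : d + 1 = c + 1 ∧ l = j
      · rw [hd.2, add_right_cancel hd.1]
      · rw [if_neg hd, add_zero] at h2
        have : d = c + 1 := by
          by_contra H
          exact h2 (if_neg fun H' => H H'.1)
        refine absurd ?_ hf
        simp [Term.form, hx _ d (by lia), hx _ (d + 1) (by lia)]
    | rung d =>
      have : d = c + 1 := by
        by_contra H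
        simp [Term.string, H] at h2
      exact absurd (by simp [Term.form, hx _ d this.ge]) hf
    | field r =>
      have : r = (c + 1, j) := by
        by_contra H
        simp [Term.string, H] at h2
      exact absurd (by simp [Term.form, this, hx _ (c + 1) le_rfl]) hf
    | flip r => simp [Term.string] at h2

/-- `X_c` tests only the `Z` part of column `c`, and a bond only the `X` parts of its two columns; a
shift by two places these below the lower end. -/
lemma form_generator_eq_zero_of_lowerBdd {B : PauliString ℤ} {p : ℤ} (hB : LowerBdd B (p + 2))
    (j : Fin 2) : (generator p j).form B = 0 := by
  obtain ⟨c, rfl | rfl⟩ := int_eq_two_mul_or p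
  · rw [generator_even]
    exact hB.snd_eq_zero (by lia) j
  · rw [generator_odd]
    simp [Term.form, hB.fst_eq_zero (c := c) (by lia) j, hB.fst_eq_zero (c := c + 1) (by lia) j]

lemma form_generator_eq_zero_of_upperBdd {B : PauliString ℤ} {q : ℤ} (hB : UpperBdd B q)
    (j : Fin 2) : (generator (q + 1) j).form B = 0 := by
  obtain ⟨c, rfl | rfl⟩ := int_eq_two_mul_or q
  · rw [generator_odd]
    simp [Term.form, hB.fst_eq_zero (c := c) (by lia) j, hB.fst_eq_zero (c := c + 1) (by lia) j]
  · rw [show 2 * c + 1 + 1 = 2 * (c + 1) by ring, generator_even]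
    exact hB.snd_eq_zero (by lia) j

lemma form_generator_succ (p : ℤ) (j l : Fin 2) :
    (generator p j).form (generator (p + 1) l).string = if j = l then 1 else 0 := by
  obtain ⟨c, rfl | rfl⟩ := int_eq_two_mul_or p
  · rw [generator_odd, generator_even]
    simp [Term.form, Term.string, eq_comm]
  · rw [show 2 * c + 1 + 1 = 2 * (c + 1) by ring, generator_odd, generator_even]
    simp [Term.form, Term.string, eq_comm]

lemma form_generator_pred (p : ℤ) (j l : Fin 2) :
    (generator (p + 1) j).form (generator p l).string = if j = l then 1 else 0 := by
  obtain ⟨c, rfl | rfl⟩ := int_eq_two_mul_or p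
  · rw [generator_odd, generator_even]
    simp [Term.form, Term.string, eq_comm]
  · rw [show 2 * c + 1 + 1 = 2 * (c + 1) by ring, generator_odd, generator_even]
    simp [Term.form, Term.string, eq_comm]

/-- Otherwise the generator would commute with its predecessor on the same leg. -/
lemma not_lowerBdd_generator (p : ℤ) (j : Fin 2) :
    ¬ LowerBdd (generator p j).string (p + 1) := by
  intro H
  have := form_generator_eq_zero_of_lowerBdd (p := p - 1) (H.mono (by lia)) j
  have h2 := form_generator_succ (p - 1) j j
  rw [sub_add_cancel, this] at h2
  simp at h2

lemma not_upperBdd_generator (p : ℤ) (j : Fin 2) :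
    ¬ UpperBdd (generator p j).string p := by
  intro H
  have := form_generator_eq_zero_of_upperBdd H j
  rw [form_generator_pred] at this
  simp at this

lemma form_generator_same (p : ℤ) (j l : Fin 2) :
    (generator p j).form (generator p l).string = 0 := by
  obtain ⟨c, rfl | rfl⟩ := int_eq_two_mul_or p
  · simp [generator_even, Term.form, Term.string]
  · simp [generator_odd, Term.form, Term.string]

/-- Test against generator `p - 1` on leg `j`: among the generators `p` it anticommutes only with
the one on its own leg, so two different legs would leave a sign that the raised bound forbids. -/
lemma leg_eq_of_lowerBdd {p : ℤ} {j l : Fin 2}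
    (H : LowerBdd ((generator p j).string + (generator p l).string) (p + 1)) : j = l := by
  have := form_generator_eq_zero_of_lowerBdd (p := p - 1) (H.mono (by lia)) j
  have h1 := form_generator_succ (p - 1) j j
  have h2 := form_generator_succ (p - 1) j l
  rw [sub_add_cancel] at h1 h2
  rw [Term.form_add, h1, h2] at this
  by_contra h
  simp [h] at this

lemma leg_eq_of_upperBdd {p : ℤ} {j l : Fin 2}
    (H : UpperBdd ((generator p j).string + (generator p l).string) p) : j = l := by
  have := form_generator_eq_zero_of_upperBdd H j
  rw [Term.form_add, form_generator_pred, form_generator_pred] at this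
  by_contra h
  simp [h] at this

/-- This supplies the generator with which a maximal string is extended at the top, the start of
every slide. -/
lemma exists_form_generator_ne_zero {A : PauliString ℤ} {q : ℤ} (hA : UpperBdd A q)
    (hA' : ¬ UpperBdd A (q - 1)) : ∃ j, (generator q j).form A ≠ 0 := by
  obtain ⟨c, rfl | rfl⟩ := int_eq_two_mul_or q
  · obtain ⟨j, hj⟩ := exists_snd_of_not_upperBdd hA hA'
    exact ⟨j, by rwa [generator_even]⟩
  · obtain ⟨j, hj⟩ := exists_fst_of_not_upperBdd hA (fun H => hA' (H.mono (by lia)))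
    refine ⟨j, ?_⟩
    rw [generator_odd]
    simpa [Term.form, hA.fst_eq_zero (c := c + 1) (by lia) j] using hj

lemma generator_ne {p q : ℤ} (h : p ≠ q) (j l : Fin 2) : generator p j ≠ generator q l := by
  intro H
  rcases lt_or_gt_of_ne h with h | h
  · exact not_lowerBdd_generator p j (H ▸ (lowerBdd_generator q l).mono (by lia))
  · exact not_lowerBdd_generator q l (H ▸ (lowerBdd_generator p j).mono (by lia))

lemma IsSolution.sum_eq_zero {C : Type*} [Add C] [One C] {g : Couplings} {D : PauliString C → ℂ}
    (hD : IsSolution g D) (B : PauliString C) (s : Finset (Term C))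
    (hs : ∀ h, h.form B ≠ 0 → D (B + h.string) ≠ 0 → h ∈ s) :
    ∑ h ∈ s, contribution g D B h = 0 := by
  rw [← hD B]
  refine (finsum_eq_sum_of_support_subset _ fun h hh => ?_).symm
  obtain ⟨h1, h2⟩ := contribution_ne_zero hh
  exact hs h h1 h2

/-! ### Length and strings of maximal length. -/

/-- All strings with nonzero coefficient have length at most `n`, measured in generators. -/
def LengthLE (D : PauliString ℤ → ℂ) (n : ℤ) : Prop :=
  ∀ B, D B ≠ 0 → ∃ p, LowerBdd B p ∧ UpperBdd B (p + n)

/-- For the equation at a string occupying `p` to `p + n + 1`, this says that every contributing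
term shortens it at one of its ends. -/
lemma LengthLE.ends {D : PauliString ℤ → ℂ} {n : ℤ} (hD : LengthLE D n) {B : PauliString ℤ}
    (hB : D B ≠ 0) (p : ℤ) : LowerBdd B (p + 1) ∨ UpperBdd B (p + n) := by
  obtain ⟨p', h1, h2⟩ := hD B hB
  rcases lt_or_ge p p' with h | h
  · exact Or.inl (h1.mono (by lia))
  · exact Or.inr (h2.mono (by lia))

/-- A string with nonzero coefficient of maximal length `n`, with lower end `p`. -/
structure IsMaximal (D : PauliString ℤ → ℂ) (n : ℤ) (A : PauliString ℤ) (p : ℤ) : Prop where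
  lower : LowerBdd A p
  not_lower : ¬ LowerBdd A (p + 1)
  upper : UpperBdd A (p + n)
  not_upper : ¬ UpperBdd A (p + n - 1)
  ne_zero : D A ≠ 0

lemma LengthLE.isMaximal {D : PauliString ℤ → ℂ} {n : ℤ} (hD : LengthLE D n) {B : PauliString ℤ}
    (hB : D B ≠ 0) {p : ℤ} (h1 : ¬ LowerBdd B (p + 1)) (h2 : ¬ UpperBdd B (p + n - 1)) :
    IsMaximal D n B p := by
  obtain ⟨p', h3, h4⟩ := hD B hB
  have : p' = p := by
    refine le_antisymm ?_ ?_ <;> by_contra! H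
    · exact h1 (h3.mono (by lia))
    · exact h2 (h4.mono (by lia))
  subst this
  exact ⟨h3, h1, h4, h2, hB⟩

/-- The string `A` starts at `p` with a generator on leg `j` that can be removed. -/
def IsLeg (A : PauliString ℤ) (p : ℤ) (j : Fin 2) : Prop :=
  LowerBdd (A + (generator p j).string) (p + 1)

lemma IsLeg.unique {A : PauliString ℤ} {p : ℤ} {j l : Fin 2} (hj : IsLeg A p j)
    (hl : IsLeg A p l) : j = l := by
  refine leg_eq_of_lowerBdd (p := p) ?_
  have h := LowerBdd.add hj hl
  rwa [show A + (generator p j).string + (A + (generator p l).string)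
    = (A + A) + ((generator p j).string + (generator p l).string) by abel, string_add_self,
    zero_add] at h

/-! ### Sliding: maximal strings are lines on one leg. -/

section Slide

variable {g : Couplings} {D : PauliString ℤ → ℂ} {n : ℤ}

lemma weight_generator_ne_zero (hJ : g.J₁ ≠ 0) (hh : g.hx ≠ 0) (p : ℤ) (j : Fin 2) :
    (generator p j).weight g ≠ 0 := by
  obtain ⟨c, rfl | rfl⟩ := int_eq_two_mul_or p
  · simpa [generator_even, Term.weight] using hh
  · simpa [generator_odd, Term.weight] using hJ

/-- Extend `A` by generator `p + n` to a string `B` that is too long. In the equation at `B` the top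
can be shortened only by returning to `A`, so some generator at the bottom must compensate. -/
lemma IsMaximal.slide (hS : IsSolution g D) (hJ : g.J₁ ≠ 0) (hh : g.hx ≠ 0) (hD : LengthLE D n)
    (hn : 1 ≤ n) {A : PauliString ℤ} {p : ℤ} (hA : IsMaximal D n A p) {j : Fin 2}
    (hj : (generator (p + n) j).form A ≠ 0) :
    ∃ l, IsLeg A p l ∧
      (generator p l).form (A + (generator (p + n) j).string + (generator p l).string) ≠ 0 ∧
      IsMaximal D n (A + (generator (p + n) j).string + (generator p l).string) (p + 1) := by
  classical
  set q := p + n with hq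
  set B := A + (generator q j).string with hB
  have hlow : LowerBdd (generator q j).string (p + 1) := (lowerBdd_generator q j).mono (by lia)
  have hBl : LowerBdd B p := hA.lower.add (hlow.mono (by lia))
  have hBl' : ¬ LowerBdd B (p + 1) := fun H => hA.not_lower (H.of_add hlow)
  have hBu : UpperBdd B (q + 1) := (hA.upper.mono (by lia)).add (upperBdd_generator q j)
  have hBu' : ¬ UpperBdd B q := fun H => by
    rw [hB, add_comm] at H
    exact not_upperBdd_generator q j (H.of_add hA.upper)
  obtain ⟨l, hl1, hl2, hl3⟩ : ∃ l, (generator p l).form B ≠ 0 ∧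
      LowerBdd (B + (generator p l).string) (p + 1) ∧ D (B + (generator p l).string) ≠ 0 := by
    -- Without a contribution from the lower end, the equation at `B` reduces to a nonzero multiple
    -- of `D A`.
    by_contra! H
    have hsum := hS.sum_eq_zero B {generator q j} (fun h h1 h2 => by
      rw [Finset.mem_singleton]
      rcases hD.ends h2 p with h3 | h3
      · obtain ⟨l, rfl⟩ := eq_generator_of_lowerBdd hBl hBl' h1 h3
        exact absurd (H l h1 h3) h2
      · obtain ⟨l, rfl⟩ := eq_generator_of_upperBdd hBu hBu' h1 h3
        have h4 : A + ((generator q j).string + (generator q l).string) =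
          B + (generator q l).string := by rw [hB, add_assoc]
        rw [← hq, ← h4, add_comm] at h3
        rw [leg_eq_of_upperBdd (h3.of_add hA.upper)])
    rw [Finset.sum_singleton, contribution_eq (by rwa [hB, Term.form_add_string]), hB,
      string_add_cancel] at hsum
    exact mul_ne_zero (weight_generator_ne_zero hJ hh q j) hA.ne_zero hsum
  have hf : (generator p l).form (B + (generator p l).string) ≠ 0 := by
    rwa [Term.form_add_string]
  refine ⟨l, ?_, hf, hD.isMaximal hl3 (fun H => ?_) (fun H => ?_)⟩
  · refine LowerBdd.of_add (B := (generator q j).string) ?_ hlow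
    rwa [show A + (generator p l).string + (generator q j).string = B + (generator p l).string by
      rw [hB]; abel]
  · exact hf (form_generator_eq_zero_of_lowerBdd (H.mono (by lia)) l)
  · exact hBu' ((H.of_add ((upperBdd_generator p l).mono (by lia))).mono (by lia))

/-- The leg persists because the generator `p` just removed anticommutes with the new string, while
it commutes with that string once the bottom generator `p + 1` is split off. So that bottom
generator lies on the leg of generator `p`. -/
lemma IsMaximal.exists_slide (hS : IsSolution g D) (hJ : g.J₁ ≠ 0) (hh : g.hx ≠ 0)
    (hD : LengthLE D n) (hn : 1 ≤ n) {A : PauliString ℤ} {p : ℤ} (hA : IsMaximal D n A p)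
    {l : Fin 2} (hl : IsLeg A p l) :
    ∃ j, (generator (p + n) j).form A ≠ 0 ∧
      IsMaximal D n (A + (generator (p + n) j).string + (generator p l).string) (p + 1) ∧
      IsLeg (A + (generator (p + n) j).string + (generator p l).string) (p + 1) l := by
  obtain ⟨j, hj⟩ := exists_form_generator_ne_zero hA.upper hA.not_upper
  obtain ⟨l', hl', hf, hM⟩ := hA.slide hS hJ hh hD hn hj
  obtain rfl := hl.unique hl'
  obtain ⟨j', hj'⟩ := exists_form_generator_ne_zero hM.upper hM.not_upper
  obtain ⟨i, hi, -⟩ := hM.slide hS hJ hh hD hn hj'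
  refine ⟨j, hj, hM, ?_⟩
  have h0 := form_generator_eq_zero_of_lowerBdd (p := p) (LowerBdd.mono hi (by lia)) l
  rw [Term.form_add, form_generator_succ] at h0
  by_cases h : l = i
  · rwa [h] at hi ⊢
  · rw [if_neg h, add_zero] at h0
    exact absurd h0 hf

/-- The string on leg `j` that is the product of the generators from `p` to `q - 1`. -/
noncomputable def line (p q : ℤ) (j : Fin 2) : PauliString ℤ :=
  ∑ t ∈ Finset.Ico p q, (generator t j).string

lemma line_self (p : ℤ) (j : Fin 2) : line p p j = 0 := by simp [line]

lemma line_succ_left {p q : ℤ} (h : p < q) (j : Fin 2) :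
    line p q j = (generator p j).string + line (p + 1) q j := by
  rw [line, ← Finset.insert_Ico_add_one_left_eq_Ico h, Finset.sum_insert (by simp), line]

lemma line_succ_right {p q : ℤ} (h : p ≤ q) (j : Fin 2) :
    line p (q + 1) j = line p q j + (generator q j).string := by
  rw [line, ← Finset.insert_Ico_right_eq_Ico_add_one h, Finset.sum_insert (by simp), line, add_comm]

lemma lowerBdd_line (p q : ℤ) (j : Fin 2) : LowerBdd (line p q j) p := by
  unfold line
  refine Finset.sum_induction _ (LowerBdd · p) (fun _ _ => LowerBdd.add) (LowerBdd.zero p) ?_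
  intro t ht
  exact (lowerBdd_generator t j).mono (Finset.mem_Ico.1 ht).1

lemma upperBdd_line (p q : ℤ) (j : Fin 2) : UpperBdd (line p q j) q := by
  unfold line
  refine Finset.sum_induction _ (UpperBdd · q) (fun _ _ => UpperBdd.add) (UpperBdd.zero q) ?_
  intro t ht
  exact (upperBdd_generator t j).mono (by have := (Finset.mem_Ico.1 ht).2; lia)

/-- Iterated slides remove a line on leg `l`. What they add on top starts at `p + n` or higher, so
for `N ≤ n` it does not affect the lower bound and can be dropped. -/
lemma IsMaximal.lowerBdd_add_line (hS : IsSolution g D) (hJ : g.J₁ ≠ 0) (hh : g.hx ≠ 0)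
    (hD : LengthLE D n) (hn : 1 ≤ n) (l : Fin 2) (N : ℕ) (hN : (N : ℤ) ≤ n) :
    ∀ {A : PauliString ℤ} {p : ℤ}, IsMaximal D n A p → IsLeg A p l →
      LowerBdd (A + line p (p + N) l) (p + N) := by
  induction N with
  | zero =>
    intro A p hA _
    simpa [line_self] using hA.lower
  | succ N ih =>
    intro A p hA hl
    obtain ⟨j, -, hM, hL⟩ := hA.exists_slide hS hJ hh hD hn hl
    have h := ih (by push_cast at hN; lia) hM hL
    push_cast at hN ⊢
    rw [show p + ((N : ℤ) + 1) = p + 1 + N by ring]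
    refine LowerBdd.of_add (B := (generator (p + n) j).string) ?_
      ((lowerBdd_generator _ j).mono (by lia))
    rwa [line_succ_left (by lia), show A + ((generator p l).string + line (p + 1) (p + 1 + N) l)
      + (generator (p + n) j).string = A + (generator (p + n) j).string + (generator p l).string
        + line (p + 1) (p + 1 + N) l by abel]

/-- One of the generators `q`, `q + 1` is a transverse field, and nothing cancels its `X` on leg
`j`: `R` ends too early, and bonds carry no `X`. -/
lemma not_lowerBdd_of_legs_ne {R : PauliString ℤ} {q : ℤ} (hR : UpperBdd R q) {j l : Fin 2}
    (h : j ≠ l) : ¬ LowerBdd (R + ((generator q j).string + (generator q l).string)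
      + ((generator (q + 1) j).string + (generator (q + 1) l).string)) (q + 2) := by
  intro H
  obtain ⟨c, rfl | rfl⟩ := int_eq_two_mul_or q
  · have h1 := H.fst_eq_zero (c := c) (by lia) j
    simp [generator_even, generator_odd, Term.string, hR.fst_eq_zero (c := c) (by lia) j,
      h.symm] at h1
  · have h1 := H.fst_eq_zero (c := c + 1) (by lia) j
    rw [show 2 * c + 1 + 1 = 2 * (c + 1) by ring] at h1
    simp [generator_even, generator_odd, Term.string, hR.fst_eq_zero (c := c + 1) (by lia) j,
      h.symm] at h1

/-- The gap of two matters: with a gap of one and `q` even, operators `Z` on a single column would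
survive. -/
lemma eq_zero_of_bdd {R : PauliString ℤ} {q : ℤ} (hl : LowerBdd R (q + 2)) (hu : UpperBdd R q) :
    R = 0 := by
  ext r
  · by_contra h
    have h1 := (hl r).1 h
    have h2 := (hu r).1 h
    lia
  · by_contra h
    have h1 := (hl r).2 h
    have h2 := (hu r).2 h
    lia

/-- The strings of maximal length are the products of consecutive generators on one leg. -/
lemma IsMaximal.eq_line (hS : IsSolution g D) (hJ : g.J₁ ≠ 0) (hh : g.hx ≠ 0)
    (hD : LengthLE D n) (hn : 1 ≤ n) {A : PauliString ℤ} {p : ℤ} (hA : IsMaximal D n A p) :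
    ∃ l, A = line p (p + n) l := by
  obtain ⟨l, hl⟩ : ∃ l, IsLeg A p l := by
    obtain ⟨j, hj⟩ := exists_form_generator_ne_zero hA.upper hA.not_upper
    obtain ⟨l, hl, -⟩ := hA.slide hS hJ hh hD hn hj
    exact ⟨l, hl⟩
  obtain ⟨j, -, hM, hL⟩ := hA.exists_slide hS hJ hh hD hn hl
  -- A second slide before the run of `n` slides produces the gap of two required by
  -- `eq_zero_of_bdd`.
  obtain ⟨i, hi, hM', hL'⟩ := hM.exists_slide hS hJ hh hD hn hL
  have h := hM'.lowerBdd_add_line hS hJ hh hD hn l n.toNat (by lia) hL'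
  rw [Int.toNat_of_nonneg (by lia)] at h
  -- Generator `p + n + 1` anticommutes with the slid string, and only the generator `p + n` just
  -- added can be responsible, so both are on the same leg.
  obtain rfl : i = j := by
    have h0 := form_generator_eq_zero_of_upperBdd hA.upper i
    have h1 := form_generator_eq_zero_of_upperBdd
      ((upperBdd_generator p l).mono (show p + 1 ≤ p + n by lia)) i
    rw [show p + 1 + n = p + n + 1 by ring, Term.form_add, Term.form_add, h0, h1,
      form_generator_pred] at hi
    by_contra H
    simp [H] at hi
  refine ⟨l, ?_⟩
  set q := p + n with hq
  set R := A + line p q l with hR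
  have hRu : UpperBdd R q := hA.upper.add (upperBdd_line p q l)
  -- All generators removed form `line p (q + 2) l`. Its last two, paired with the two added on leg
  -- `i`, are what separates the result from `R`.
  have hE : LowerBdd (R + ((generator q i).string + (generator q l).string)
      + ((generator (q + 1) i).string + (generator (q + 1) l).string)) (q + 2) := by
    have e1 : line p (q + 1 + 1) l =
        line p q l + (generator q l).string + (generator (q + 1) l).string := by
      rw [line_succ_right (by lia), line_succ_right (by lia)]
    have e2 : line p (q + 1 + 1) l = (generator p l).string + ((generator (p + 1) l).string +
        line (p + 1 + 1) (q + 1 + 1) l) := by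
      rw [line_succ_left (by lia), line_succ_left (by lia)]
    rw [show p + 1 + 1 + n = q + 1 + 1 by lia, show p + 1 + n = q + 1 by lia] at h
    convert h using 1
    · rw [hR]
      calc _ = A + (generator q i).string + (generator (q + 1) i).string + (line p q l
            + (generator q l).string + (generator (q + 1) l).string) := by abel
        _ = _ := by rw [← e1, e2]; abel
    · ring
  have hil : i = l := by
    by_contra H
    exact not_lowerBdd_of_legs_ne hRu H hE
  rw [hil, string_add_self, string_add_self, add_zero, add_zero] at hE
  have h0 := eq_zero_of_bdd hE hRu
  have h1 := string_add_cancel A (line p q l)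
  rw [← hR, h0, zero_add] at h1
  exact h1.symm

end Slide

/-! ### A rung defect in a line, and descent in the length. -/

section Descent

variable {g : Couplings} {D : PauliString ℤ → ℂ} {n : ℤ}

lemma not_lowerBdd_line {p q : ℤ} (h : p < q) (j : Fin 2) : ¬ LowerBdd (line p q j) (p + 1) := by
  intro H
  rw [line_succ_left h] at H
  exact not_lowerBdd_generator p j (H.of_add (lowerBdd_line _ _ j))

lemma not_upperBdd_line {p q : ℤ} (h : p ≤ q) (j : Fin 2) : ¬ UpperBdd (line p (q + 1) j) q := by
  intro H
  rw [line_succ_right h, add_comm] at H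
  exact not_upperBdd_generator q j (H.of_add (upperBdd_line _ _ j))

lemma form_generator_line_left {p q : ℤ} (h : p + 2 ≤ q) (j : Fin 2) :
    (generator p j).form (line p q j) = 1 := by
  rw [line_succ_left (by lia), line_succ_left (by lia), Term.form_add, Term.form_add,
    form_generator_same, form_generator_succ, if_pos rfl,
    form_generator_eq_zero_of_lowerBdd ((lowerBdd_line _ _ j).mono (by lia))]
  simp

lemma form_generator_line_right {p q : ℤ} (h : p + 1 ≤ q) (j : Fin 2) :
    (generator q j).form (line p (q + 1) j) = 1 := by
  obtain ⟨r, rfl⟩ : ∃ r, q = r + 1 := ⟨q - 1, by ring⟩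
  rw [line_succ_right (by lia), line_succ_right (by lia), Term.form_add, Term.form_add,
    form_generator_same, form_generator_pred, if_pos rfl,
    form_generator_eq_zero_of_upperBdd (upperBdd_line _ _ j)]
  simp

/-- The term that raises the lower end of a string starting with a line on leg `j` is the first
generator of the line. -/
lemma eq_generator_of_lowerBdd_line_add {p q : ℤ} (hpq : p < q) {j : Fin 2} {E : PauliString ℤ}
    (hE : LowerBdd E (p + 1)) {h : Term ℤ} (hf : h.form (line p q j + E) ≠ 0)
    (hh : LowerBdd (line p q j + E + h.string) (p + 1)) : h = generator p j := by
  obtain ⟨l, rfl⟩ := eq_generator_of_lowerBdd ((lowerBdd_line p q j).add (hE.mono (by lia)))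
    (fun H => not_lowerBdd_line hpq j (H.of_add hE)) hf hh
  rw [line_succ_left hpq, show (generator p j).string + line (p + 1) q j + E
    + (generator p l).string = (generator p j).string + (generator p l).string
      + (line (p + 1) q j + E) by abel] at hh
  rw [leg_eq_of_lowerBdd (hh.of_add ((lowerBdd_line _ _ j).add hE))]

lemma eq_generator_of_upperBdd_line_add {p q : ℤ} (hpq : p ≤ q) {j : Fin 2} {E : PauliString ℤ}
    (hE : UpperBdd E q) {h : Term ℤ} (hf : h.form (line p (q + 1) j + E) ≠ 0)
    (hh : UpperBdd (line p (q + 1) j + E + h.string) q) : h = generator q j := by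
  obtain ⟨l, rfl⟩ := eq_generator_of_upperBdd ((upperBdd_line p _ j).add (hE.mono (by lia)))
    (fun H => not_upperBdd_line hpq j (H.of_add hE)) hf hh
  rw [line_succ_right hpq, show line p q j + (generator q j).string + E
    + (generator q l).string = (generator q j).string + (generator q l).string
      + (line p q j + E) by abel] at hh
  rw [leg_eq_of_upperBdd (hh.of_add ((upperBdd_line _ _ j).add hE))]

lemma line_add_generator_left {p q : ℤ} (h : p < q) (j : Fin 2) (E : PauliString ℤ) :
    line p q j + E + (generator p j).string = line (p + 1) q j + E := by
  rw [line_succ_left h, show (generator p j).string + line (p + 1) q j + E + (generator p j).string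
    = (generator p j).string + (generator p j).string + (line (p + 1) q j + E) by abel,
    string_add_self, zero_add]

lemma line_add_generator_right {p q : ℤ} (h : p ≤ q) (j : Fin 2) (E : PauliString ℤ) :
    line p (q + 1) j + E + (generator q j).string = line p q j + E := by
  rw [line_succ_right h, show line p q j + (generator q j).string + E + (generator q j).string
    = (generator q j).string + (generator q j).string + (line p q j + E) by abel,
    string_add_self, zero_add]

/-- The coefficients of the lines of maximal length are related by translation. -/
lemma line_relation (hS : IsSolution g D) (hD : LengthLE D n) (hn : 1 ≤ n) (p : ℤ) (j : Fin 2) :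
    (generator p j).weight g * D (line (p + 1) (p + 1 + n) j)
      + (generator (p + n) j).weight g * D (line p (p + n) j) = 0 := by
  classical
  have key := hS.sum_eq_zero (line p (p + n + 1) j) {generator p j, generator (p + n) j}
    (fun h h1 h2 => by
      rw [Finset.mem_insert, Finset.mem_singleton]
      rw [← add_zero (line p (p + n + 1) j)] at h1 h2
      exact (hD.ends h2 p).imp
        (eq_generator_of_lowerBdd_line_add (by lia) (LowerBdd.zero _) h1)
        (eq_generator_of_upperBdd_line_add (by lia) (UpperBdd.zero _) h1))
  have e1 := line_add_generator_left (show p < p + n + 1 by lia) j 0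
  have e2 := line_add_generator_right (show p ≤ p + n by lia) j 0
  simp only [add_zero] at e1 e2
  rw [Finset.sum_pair (generator_ne (by lia) _ _),
    contribution_eq (by rw [form_generator_line_left (by lia)]; exact one_ne_zero),
    contribution_eq (by rw [form_generator_line_right (by lia)]; exact one_ne_zero), e1, e2] at key
  rwa [show p + 1 + n = p + n + 1 by ring]

lemma rung_string_fst (c : ℤ) (r : ℤ × Fin 2) : ((Term.rung c).string r).1 = 0 := by
  simp [Term.string]

lemma rung_string_snd (c d : ℤ) (l : Fin 2) :
    ((Term.rung c).string (d, l)).2 = if c = d then 1 else 0 := by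
  fin_cases l <;> simp [Term.string]

lemma lowerBdd_rung (c : ℤ) : LowerBdd (Term.rung c).string (2 * c + 1) := by
  rintro ⟨d, l⟩
  simp only [rung_string_fst, rung_string_snd]
  exact ⟨by simp, fun h => by have : c = d := by simpa using h
                              lia⟩

lemma upperBdd_rung (c : ℤ) : UpperBdd (Term.rung c).string (2 * c) := by
  rintro ⟨d, l⟩
  simp only [rung_string_fst, rung_string_snd]
  exact ⟨by simp, fun h => by have : c = d := by simpa using h
                              lia⟩

lemma form_generator_rung (p c : ℤ) (j : Fin 2) :
    (generator p j).form (Term.rung c).string = if p = 2 * c then 1 else 0 := by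
  obtain ⟨d, rfl | rfl⟩ := int_eq_two_mul_or p
  · simp [generator_even, Term.form, rung_string_snd, eq_comm]
  · rw [generator_odd, if_neg (by lia)]
    simp [Term.form, rung_string_fst]

lemma generator_ne_rung (p c : ℤ) (j : Fin 2) : generator p j ≠ Term.rung c := by
  obtain ⟨d, rfl | rfl⟩ := int_eq_two_mul_or p
  · simp [generator_even]
  · simp [generator_odd]

lemma line_fst {p q c : ℤ} (hp : p ≤ 2 * c) (hq : 2 * c + 1 ≤ q) (j l : Fin 2) :
    (line p q j (c, l)).1 = if j = l then 1 else 0 := by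
  have hval : ∀ t, ((generator t j).string (c, l)).1
      = if t = 2 * c then (if j = l then 1 else 0) else 0 := by
    intro t
    obtain ⟨d, rfl | rfl⟩ := int_eq_two_mul_or t
    · rw [generator_even]
      by_cases h : d = c <;> simp [Term.string, h]
    · rw [generator_odd, if_neg (by lia)]
      simp [Term.string]
  have : (line p q j (c, l)).1 = ∑ t ∈ Finset.Ico p q, ((generator t j).string (c, l)).1 := by
    rw [line, Finsupp.finsetSum_apply, Prod.fst_sum]
  rw [this, Finset.sum_congr rfl fun t _ => hval t, Finset.sum_ite_eq', if_pos]
  rw [Finset.mem_Ico]; lia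

lemma eq_rung_of_string_eq {h : Term ℤ} {c : ℤ} (hh : h.string = (Term.rung c).string) :
    h = Term.rung c := by
  have h1 : ∀ r, (h.string r).1 = 0 := fun r => by rw [hh, rung_string_fst]
  have h2 : ∀ l, (h.string (c, l)).2 = 1 := fun l => by rw [hh, rung_string_snd, if_pos rfl]
  have a := h2 0
  have b := h2 1
  cases h with
  | bond r =>
    obtain ⟨d, l⟩ := r
    fin_cases l <;> simp [Term.string] at a b
  | rung d =>
    rw [rung_string_snd] at a
    by_contra H
    rw [if_neg (by rintro rfl; exact H rfl)] at a
    simp at a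
  | field r =>
    obtain ⟨d, l⟩ := r
    fin_cases l <;> simp [Term.string] at a b
  | flip r => simp [Term.string] at a

lemma form_rung_line {p q c : ℤ} (hp : p ≤ 2 * c) (hq : 2 * c + 1 ≤ q) (j : Fin 2) :
    (Term.rung c).form (line p q j) = 1 := by
  simp only [Term.form, line_fst hp hq]
  fin_cases j <;> simp

/-- A product of full length is again a line. If it were on the other leg, `h` would carry `X` on
both sites of column `c`, which no term does. -/
lemma string_eq_of_maximal (hS : IsSolution g D) (hJ : g.J₁ ≠ 0) (hh : g.hx ≠ 0)
    (hD : LengthLE D n) (hn : 1 ≤ n) {c p : ℤ} (hp : p ≤ 2 * c) (hq : 2 * c + 1 ≤ p + n)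
    {j : Fin 2} {E : PauliString ℤ} (hE : ∀ i, (E (c, i)).1 = 0) {h : Term ℤ}
    (hM : IsMaximal D n (line p (p + n) j + E + h.string) p) : h.string = E := by
  obtain ⟨l, hl⟩ := hM.eq_line hS hJ hh hD hn
  have hs : h.string = line p (p + n) l + line p (p + n) j + E := by
    rw [← hl, show line p (p + n) j + E + h.string + line p (p + n) j
      + E = h.string + (line p (p + n) j + line p (p + n) j) + (E + E) by abel]
    simp only [string_add_self, add_zero]
  by_cases hlj : l = j
  · rwa [hlj, string_add_self, zero_add] at hs
  · exfalso
    have hx : ∀ i, (h.string (c, i)).1 = 1 := by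
      intro i
      rw [hs, Finsupp.add_apply, Finsupp.add_apply, Prod.fst_add, Prod.fst_add, line_fst hp hq,
        line_fst hp hq, hE]
      fin_cases i <;> fin_cases l <;> fin_cases j <;> simp at hlj ⊢
    have a := hx 0
    have b := hx 1
    cases h with
    | flip r =>
      obtain ⟨d, i⟩ := r
      fin_cases i <;> simp [Term.string] at a b
    | _ => simp [Term.string] at a

/-- The equation at a line of maximal length multiplied by a coupling along a rung. -/
lemma defect_relation (hS : IsSolution g D) (hJ : g.J₁ ≠ 0) (hh : g.hx ≠ 0)
    (hD : LengthLE D n) (hn : 2 ≤ n) {c p : ℤ} (hp : p ≤ 2 * c) (hq : 2 * c + 1 ≤ p + n)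
    (j : Fin 2) :
    (if p = 2 * c then 0 else
      (generator p j).weight g * D (line (p + 1) (p + n) j + (Term.rung c).string))
    + ((if p + n - 1 = 2 * c then 0 else
      (generator (p + n - 1) j).weight g * D (line p (p + n - 1) j + (Term.rung c).string))
    + g.J₂ * D (line p (p + n) j)) = 0 := by
  classical
  obtain ⟨m, rfl⟩ : ∃ m, n = m + 1 := ⟨n - 1, by ring⟩
  simp only [show p + (m + 1) = p + m + 1 by ring, add_sub_cancel_right] at hq ⊢
  set E := (Term.rung c).string with hE
  have hEl : LowerBdd E (p + 1) := (lowerBdd_rung c).mono (by lia)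
  have hEu : UpperBdd E (p + m) := (upperBdd_rung c).mono (by lia)
  have key := hS.sum_eq_zero (line p (p + m + 1) j + E)
    {generator p j, generator (p + m) j, Term.rung c} (fun h h1 h2 => by
      rw [Finset.mem_insert, Finset.mem_insert, Finset.mem_singleton]
      -- A contributing term shortens the line at one end or preserves the full length; in the
      -- latter case it can only be the rung itself.
      by_cases h3 : LowerBdd (line p (p + m + 1) j + E + h.string) (p + 1)
      · exact Or.inl (eq_generator_of_lowerBdd_line_add (by lia) hEl h1 h3)
      by_cases h4 : UpperBdd (line p (p + m + 1) j + E + h.string) (p + m)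
      · exact Or.inr (Or.inl (eq_generator_of_upperBdd_line_add (by lia) hEu h1 h4))
      refine Or.inr (Or.inr (eq_rung_of_string_eq (string_eq_of_maximal hS hJ hh hD (by lia) hp
        (by lia) (j := j) (fun i => rung_string_fst c _) ?_)))
      rw [show p + (m + 1) = p + m + 1 by ring]
      exact hD.isMaximal h2 h3 (by rwa [show p + (m + 1) - 1 = p + m by ring]))
  rw [Finset.sum_insert, Finset.sum_pair (generator_ne_rung _ _ _)] at key
  · refine Eq.trans (congrArg₂ (· + ·) ?_ (congrArg₂ (· + ·) ?_ ?_)) key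
    · rw [contribution, Term.form_add, form_generator_line_left (by lia), form_generator_rung,
        line_add_generator_left (by lia)]
      -- If the line begins with the transverse field of column `c`, this generator anticommutes
      -- with both the line and the rung, hence commutes with the product and drops out.
      by_cases h : p = 2 * c
      · simp [h, CharTwo.add_self_eq_zero]
      · simp [h]
    · rw [contribution, Term.form_add, form_generator_line_right (by lia), form_generator_rung,
        line_add_generator_right (by lia)]
      by_cases h : p + m = 2 * c
      · simp [h, CharTwo.add_self_eq_zero]
      · simp [h]
    · rw [contribution_eq, string_add_cancel]
      · rfl
      · rw [Term.form_add, Term.form_string_self, form_rung_line hp (by lia)]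
        simp
  · rw [Finset.mem_insert, Finset.mem_singleton]
    rintro (h | h)
    · exact generator_ne (by lia) _ _ h
    · exact generator_ne_rung _ _ _ h

/-- A solution of the recurrence along which a defect is moved through a line. -/
lemma recurrence_boundary {n : ℕ} (hn : 1 ≤ n) {s a v : ℤ → ℂ} {J : ℂ} (hs : ∀ p, s p ≠ 0)
    {p₀ : ℤ} (ha : ∀ p, s p * a (p + 1) + s (p + n) * a p = 0)
    (h : ∀ m : ℕ, m < n → (if m = n - 1 then 0 else s (p₀ + m) * v (p₀ + m + 1))
      + ((if m = 0 then 0 else s (p₀ + m + n - 1) * v (p₀ + m)) + J * a (p₀ + m)) = 0) :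
    n * J * a (p₀ + (n - 1 : ℕ)) = 0 := by
  -- The defect amplitudes telescope: by `ha` every position contributes the same amount when
  -- transported along the line, whence the factor `m + 1`.
  have claim : ∀ m : ℕ, m + 1 < n →
      s (p₀ + m) * v (p₀ + m + 1) = -((m + 1 : ℕ) * J * a (p₀ + m)) := by
    intro m
    induction m with
    | zero =>
      intro hm
      have h0 := h 0 (by lia)
      rw [if_neg (by lia), if_pos rfl] at h0
      push_cast at h0 ⊢
      linear_combination h0
    | succ m ih =>
      intro hm
      have h0 := h (m + 1) (by lia)
      rw [if_neg (by lia), if_neg (by lia)] at h0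
      have h1 := ih (by lia)
      have h2 := ha (p₀ + m)
      push_cast at h0 h1 ⊢
      simp only [← add_assoc] at h0 ⊢
      rw [show p₀ + (m : ℤ) + 1 + n - 1 = p₀ + m + n by ring] at h0
      refine mul_left_cancel₀ (hs (p₀ + m)) ?_
      linear_combination s (p₀ + m) * h0 - s (p₀ + m + n) * h1 + (m + 1) * J * h2
  -- The last position has no outgoing amplitude, so the accumulated multiple must vanish.
  have h0 := h (n - 1) (by lia)
  rw [if_pos rfl] at h0
  by_cases hn1 : n - 1 = 0
  · rw [if_pos hn1] at h0
    have : n = 1 := by lia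
    subst this
    push_cast
    linear_combination h0
  · obtain ⟨m, rfl⟩ : ∃ m, n = m + 2 := ⟨n - 2, by lia⟩
    rw [if_neg hn1] at h0
    have h1 := claim m (by lia)
    have h2 := ha (p₀ + m)
    simp only [show m + 2 - 1 = m + 1 by lia] at h0 ⊢
    push_cast at h0 h1 h2 ⊢
    simp only [← add_assoc] at h0 h2 ⊢
    rw [show p₀ + (m : ℤ) + 1 + m + 2 - 1 = p₀ + m + m + 2 by ring] at h0
    refine mul_left_cancel₀ (hs (p₀ + m)) ?_
    rw [mul_zero]
    linear_combination s (p₀ + m) * h0 - s (p₀ + m + m + 2) * h1 + (m + 1) * J * h2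

/-- The defect recurrence handles lines starting at a transverse field, and the translation relation
the others. For `n = 1` the argument fails: the two ends are the same generator, which anticommutes
with the defect and contributes. -/
lemma line_coeff_eq_zero (hS : IsSolution g D) (hJ : g.J₁ ≠ 0) (hJ₂ : g.J₂ ≠ 0) (hh : g.hx ≠ 0)
    (hD : LengthLE D n) (hn : 2 ≤ n) (p : ℤ) (j : Fin 2) : D (line p (p + n) j) = 0 := by
  obtain ⟨N, rfl⟩ : ∃ N : ℕ, n = N := ⟨n.toNat, by lia⟩
  have hs := weight_generator_ne_zero (g := g) hJ hh
  have heven : ∀ c : ℤ, D (line (2 * c) (2 * c + N) j) = 0 := by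
    intro c
    -- A line of `N` generators contains `X_c` exactly when it starts between `2 * c + 1 - N` and `2
    -- * c`; the coefficient at the last start is the one shown to vanish.
    have := recurrence_boundary (n := N) (by lia) (s := fun p => (generator p j).weight g)
      (a := fun p => D (line p (p + N) j))
      (v := fun p => D (line p (p + N - 1) j + (Term.rung c).string)) (J := g.J₂)
      (fun p => hs p j) (p₀ := 2 * c + 1 - N)
      (fun p => line_relation hS hD (by lia) p j) (fun m hm => by
        have h := defect_relation hS hJ hh hD hn (c := c) (p := 2 * c + 1 - N + m) (by lia)
          (by lia) j
        convert h using 2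
        · by_cases hm' : m = N - 1
          · rw [if_pos hm', if_pos (by lia)]
          · rw [if_neg hm', if_neg (by lia)]
            congr 4; lia
        · congr 1
          by_cases hm' : m = 0
          · rw [if_pos hm', if_pos (by lia)]
          · rw [if_neg hm', if_neg (by lia)])
    have hN : (N : ℂ) ≠ 0 := Nat.cast_ne_zero.2 (by lia)
    have h0 := (mul_eq_zero.1 this).resolve_left (mul_ne_zero hN hJ₂)
    convert h0 using 3 <;> lia
  obtain ⟨c, rfl | rfl⟩ := int_eq_two_mul_or p
  · exact heven c
  · have := line_relation hS hD (by lia) (2 * c) j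
    rw [heven c, mul_zero, add_zero] at this
    exact (mul_eq_zero.1 this).resolve_left (hs _ j)

/-- The length of the strings with nonzero coefficient can be lowered. -/
lemma LengthLE.descend (hS : IsSolution g D) (hJ : g.J₁ ≠ 0) (hJ₂ : g.J₂ ≠ 0) (hh : g.hx ≠ 0)
    (hn : 1 ≤ n) (hD : LengthLE D (n + 1)) : LengthLE D n := by
  intro B hB
  obtain ⟨p, h1, h2⟩ := hD B hB
  by_cases h3 : LowerBdd B (p + 1)
  · exact ⟨p + 1, h3, h2.mono (by lia)⟩
  by_cases h4 : UpperBdd B (p + n)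
  · exact ⟨p, h1, h4⟩
  obtain ⟨l, rfl⟩ := (hD.isMaximal hB h3 (by rwa [← add_assoc, add_sub_cancel_right])).eq_line
    hS hJ hh hD (by lia)
  exact absurd (line_coeff_eq_zero hS hJ hJ₂ hh hD (by lia) p l) hB

lemma LengthLE.one (hS : IsSolution g D) (hJ : g.J₁ ≠ 0) (hJ₂ : g.J₂ ≠ 0) (hh : g.hx ≠ 0)
    (N : ℕ) (hD : LengthLE D (N + 1)) : LengthLE D 1 := by
  induction N with
  | zero => simpa using hD
  | succ N ih => exact ih (LengthLE.descend hS hJ hJ₂ hh (by lia) (by exact_mod_cast hD))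

end Descent

/-! ### Solutions of length one. -/

section ShortSolutions

variable {g : Couplings} {D : PauliString ℤ → ℂ}

lemma line_one (p : ℤ) (j : Fin 2) : line p (p + 1) j = (generator p j).string := by
  rw [line_succ_left (by lia), line_self, add_zero]

lemma eq_field_of_string_eq {h : Term ℤ} {r : ℤ × Fin 2} (hh : h.string = zString r) :
    h = Term.field r := by
  have h1 : ∀ s, (h.string s).1 = 0 := fun s => by rw [hh, zString_fst]
  have h2 : ∀ s, (h.string s).2 = if r = s then 1 else 0 := fun s => by rw [hh, zString_snd]
  cases h with
  | bond s =>
    obtain ⟨c, j⟩ := s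
    have a := h2 (c, j)
    have b := h2 (c + 1, j)
    simp [Term.string] at a b
    rw [a] at b
    simp at b
  | rung c =>
    have a := h2 (c, 0)
    have b := h2 (c, 1)
    simp [Term.string] at a b
    rw [a] at b
    simp at b
  | field s =>
    have a := h2 s
    simp [Term.string] at a
    rw [a]
  | flip s =>
    have := h1 s
    simp [Term.string] at this

/-- A string without extent in the order of the generators consists of operators `Z` on one
column. -/
lemma eq_string_of_bdd {B : PauliString ℤ} {p : ℤ} (hl : LowerBdd B p) (hu : UpperBdd B p)
    (hB : B ≠ 0) : ∃ h : Term ℤ, B = h.string := by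
  obtain ⟨c, hc⟩ : ∃ c, p = 2 * c ∨ p = 2 * c + 1 := int_eq_two_mul_or p
  have hx : ∀ s, (B s).1 = 0 := by
    intro s
    by_contra h
    have h1 := (hl s).1 h
    have h2 := (hu s).1 h
    lia
  have hz : ∀ d l, d ≠ c → (B (d, l)).2 = 0 := by
    intro d l hd
    by_contra h
    have h1 := (hl (d, l)).2 h
    have h2 := (hu (d, l)).2 h
    simp only at h1 h2
    lia
  have hext : ∀ h : Term ℤ, (∀ s, (h.string s).1 = 0) →
      (∀ d l, d ≠ c → (h.string (d, l)).2 = 0) → (∀ l, (B (c, l)).2 = (h.string (c, l)).2) →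
      B = h.string := by
    intro h h1 h2 h3
    ext s
    · rw [hx, h1]
    · obtain ⟨d, l⟩ := s
      by_cases hd : d = c
      · rw [hd, h3]
      · rw [hz d l hd, h2 d l hd]
  have hz2 : ∀ l, (B (c, l)).2 = 0 ∨ (B (c, l)).2 = 1 := fun l => by
    generalize (B (c, l)).2 = a
    revert a; decide
  rcases hz2 0 with h0 | h0 <;> rcases hz2 1 with h1 | h1
  · refine absurd ?_ hB
    ext s
    · simp [hx]
    · obtain ⟨d, l⟩ := s
      by_cases hd : d = c
      · subst hd
        fin_cases l <;> simp [h0, h1]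
      · simp [hz d l hd]
  · refine ⟨Term.field (c, 1), hext _ (by simp [Term.string]) ?_ ?_⟩
    · intro d l hd
      simp [Term.string, hd.symm]
    · intro l
      fin_cases l <;> simp [Term.string, h0, h1]
  · refine ⟨Term.field (c, 0), hext _ (by simp [Term.string]) ?_ ?_⟩
    · intro d l hd
      simp [Term.string, hd.symm]
    · intro l
      fin_cases l <;> simp [Term.string, h0, h1]
  · refine ⟨Term.rung c, hext _ (rung_string_fst c) ?_ ?_⟩
    · intro d l hd
      rw [rung_string_snd, if_neg hd.symm]
    · intro l
      rw [rung_string_snd, if_pos rfl]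
      fin_cases l <;> simp [h0, h1]

/-- At full length the string is a line with one generator; below that it is a field or a rung. -/
lemma LengthLE.eq_string (hS : IsSolution g D) (hJ : g.J₁ ≠ 0) (hh : g.hx ≠ 0)
    (hD : LengthLE D 1) {B : PauliString ℤ} (hB : B ≠ 0) (hDB : D B ≠ 0) :
    ∃ h : Term ℤ, B = h.string := by
  obtain ⟨p, h1, h2⟩ := hD B hDB
  by_cases h3 : LowerBdd B (p + 1)
  · exact eq_string_of_bdd h3 h2 hB
  by_cases h4 : UpperBdd B p
  · exact eq_string_of_bdd h1 h4 hB
  obtain ⟨l, hl⟩ := (hD.isMaximal hDB h3 (by rwa [add_sub_cancel_right])).eq_line hS hJ hh hD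
    le_rfl
  exact ⟨generator p l, by rw [hl, line_one]⟩

/-- The equation at `X E`, where `E` is a product of operators `Z` on the same column. -/
lemma single_site_relation (hS : IsSolution g D) (hJ : g.J₁ ≠ 0) (hh : g.hx ≠ 0)
    (hD : LengthLE D 1) {c : ℤ} {j : Fin 2} {h' : Term ℤ} (hl : LowerBdd h'.string (2 * c + 1))
    (hu : UpperBdd h'.string (2 * c)) (huniq : ∀ h : Term ℤ, h.string = h'.string → h = h')
    (hf : h'.form (xString (c, j)) ≠ 0) (hx : (h'.string (c, j)).2 ≠ 0)
    (hne : h' ≠ Term.flip (c, j)) :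
    g.hx * D h'.string = h'.weight g * D (xString (c, j)) := by
  classical
  have hline : line (2 * c) (2 * c + 1) j = xString (c, j) := by
    rw [line_one, generator_even]; rfl
  have key := hS.sum_eq_zero (line (2 * c) (2 * c + 1) j + h'.string) {Term.flip (c, j), h'}
    (fun h h1 h2 => by
      rw [Finset.mem_insert, Finset.mem_singleton, ← generator_even]
      by_cases h3 : LowerBdd (line (2 * c) (2 * c + 1) j + h'.string + h.string) (2 * c + 1)
      · exact Or.inl (eq_generator_of_lowerBdd_line_add (by lia) hl h1 h3)
      by_cases h4 : UpperBdd (line (2 * c) (2 * c + 1) j + h'.string + h.string) (2 * c)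
      · exact Or.inl (eq_generator_of_upperBdd_line_add (by lia) hu h1 h4)
      exact Or.inr (huniq _ (string_eq_of_maximal hS hJ hh hD le_rfl (c := c) le_rfl le_rfl
        (fun i => hl.fst_eq_zero (by lia) i)
        (hD.isMaximal h2 h3 (by rwa [add_sub_cancel_right])))))
  rw [hline, Finset.sum_pair hne.symm, contribution_eq, contribution_eq, string_add_cancel] at key
  · have e : xString (c, j) + h'.string + (Term.flip (c, j)).string = h'.string := by
      rw [add_comm (xString _)]
      exact string_add_cancel _ _
    rw [e, show (Term.flip (c, j) : Term ℤ).weight g = -g.hx from rfl] at key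
    linear_combination -key
  · rwa [Term.form_add_string]
  · simpa [Term.form] using hx

/-- The short solutions are the multiples of the Hamiltonian, up to the coefficient of the
identity. -/
theorem LengthLE.eq_smul_coeff (hS : IsSolution g D) (hJ : g.J₁ ≠ 0) (hJ₂ : g.J₂ ≠ 0)
    (hh : g.hx ≠ 0) (hD : LengthLE D 1) :
    ∃ β : ℂ, ∀ h : Term ℤ, D h.string = β * h.coeff g := by
  have hgen : ∀ j, ∃ β : ℂ, ∀ p, D (generator p j).string = β * (generator p j).coeff g := by
    intro j
    refine ⟨D (generator 0 j).string / g.hx, fun p => ?_⟩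
    have hrel : ∀ p, (generator p j).weight g * D (generator (p + 1) j).string
        + (generator (p + 1) j).weight g * D (generator p j).string = 0 := by
      intro p
      have := line_relation hS hD le_rfl p j
      rwa [line_one, line_one] at this
    -- The Hamiltonian commutes with itself: its coefficients obey the same first-order recurrence
    -- as `D`, so one value determines the ratio on the whole leg.
    have hco : ∀ p, (generator p j).weight g * (generator (p + 1) j).coeff g
        + (generator (p + 1) j).weight g * (generator p j).coeff g = 0 := by
      intro p
      obtain ⟨c, rfl | rfl⟩ := int_eq_two_mul_or p
      · simp only [generator_even, generator_odd, Term.weight, Term.coeff]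
        ring
      · rw [show 2 * c + 1 + 1 = 2 * (c + 1) by ring]
        simp only [generator_even, generator_odd, Term.weight, Term.coeff]
        ring
    have hw := fun p => weight_generator_ne_zero (g := g) hJ hh p j
    set β := D (generator 0 j).string / g.hx with hβ
    induction p using Int.induction_on with
    | zero =>
      have : (generator 0 j).coeff g = g.hx := by
        rw [show (0 : ℤ) = 2 * 0 by rfl, generator_even]; rfl
      rw [this, hβ, div_mul_cancel₀ _ hh]
    | succ p ih =>
      refine mul_left_cancel₀ (hw p) ?_
      linear_combination hrel p - β * hco p - (generator (p + 1) j).weight g * ih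
    | pred p ih =>
      have h1 := hrel (-p - 1)
      have h2 := hco (-p - 1)
      rw [sub_add_cancel] at h1 h2
      refine mul_left_cancel₀ (hw (-p)) ?_
      linear_combination h1 - β * h2 - (generator (-p - 1) j).weight g * ih
  choose β hβ using hgen
  have hX : ∀ c j, D (xString (c, j)) = β j * g.hx := by
    intro c j
    have := hβ j (2 * c)
    rwa [generator_even] at this
  have hrung : ∀ c j, D (Term.rung c).string = β j * g.J₂ := by
    intro c j
    have := single_site_relation hS hJ hh hD (j := j) (lowerBdd_rung c) (upperBdd_rung c)
      (fun h => eq_rung_of_string_eq)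
      (by fin_cases j <;> simp [Term.form]) (by rw [rung_string_snd, if_pos rfl]; exact one_ne_zero)
      (by simp)
    rw [hX] at this
    simp only [Term.weight] at this
    refine mul_left_cancel₀ hh ?_
    linear_combination this
  -- The coefficient of a rung can be computed from either leg, which equates the two factors
  -- because `J₂ ≠ 0`.
  have hβ01 : ∀ j, β j = β 0 := fun j =>
    mul_right_cancel₀ hJ₂ ((hrung 0 j).symm.trans (hrung 0 0))
  have hfield : ∀ c j, D (zString (c, j)) = β j * g.hz := by
    intro c j
    have := single_site_relation hS hJ hh hD (c := c) (j := j) (h' := Term.field (c, j))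
      (by rintro ⟨d, l⟩; simp [Term.string]; lia) (by rintro ⟨d, l⟩; simp [Term.string]; lia)
      (fun h => eq_field_of_string_eq) (by simp [Term.form]) (by simp [Term.string]) (by simp)
    rw [hX] at this
    simp only [Term.weight, Term.string] at this
    refine mul_left_cancel₀ hh ?_
    linear_combination this
  refine ⟨β 0, fun h => ?_⟩
  cases h with
  | bond r =>
    have := hβ r.2 (2 * r.1 + 1)
    rwa [generator_odd, hβ01] at this
  | rung c => exact hrung c 0
  | field r => rw [← hβ01 r.2]; exact hfield r.1 r.2
  | flip r => rw [← hβ01 r.2]; exact hX r.1 r.2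

end ShortSolutions

/-! ### From operators to coefficients: Pauli strings as matrices. -/

section Operators

/-- The nontrivial character of `ℤ / 2`. -/
noncomputable def signChar (a : ZMod 2) : ℂ := if a = 0 then 1 else -1

lemma zmod_two_cases (a : ZMod 2) : a = 0 ∨ a = 1 := by
  revert a; decide

lemma signChar_zero : signChar 0 = 1 := by simp [signChar]

lemma signChar_add (a b : ZMod 2) : signChar (a + b) = signChar a * signChar b := by
  rcases zmod_two_cases a with rfl | rfl <;> rcases zmod_two_cases b with rfl | rfl <;>
    simp [signChar, CharTwo.add_self_eq_zero]

lemma signChar_ne_zero (a : ZMod 2) : signChar a ≠ 0 := by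
  unfold signChar; split_ifs <;> simp

lemma signChar_sum {ι : Type*} (s : Finset ι) (f : ι → ZMod 2) :
    signChar (∑ i ∈ s, f i) = ∏ i ∈ s, signChar (f i) := by
  classical
  induction s using Finset.induction_on with
  | empty => simp [signChar_zero]
  | insert i s hi ih => rw [Finset.sum_insert hi, Finset.prod_insert hi, signChar_add, ih]

/-- The matrix `X ^ x * Z ^ z`. -/
noncomputable def exponentMatrix (v : PauliExponents) : Matrix (Fin 2) (Fin 2) ℂ :=
  (if v.1 = 0 then 1 else Pauli.X.matrix) * (if v.2 = 0 then 1 else Pauli.Z.matrix)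

lemma exponentMatrix_mul (v w : PauliExponents) :
    exponentMatrix v * exponentMatrix w = signChar (v.2 * w.1) • exponentMatrix (v + w) := by
  obtain ⟨a, b⟩ := v
  obtain ⟨c, d⟩ := w
  rcases zmod_two_cases a with rfl | rfl <;> rcases zmod_two_cases b with rfl | rfl <;>
  rcases zmod_two_cases c with rfl | rfl <;> rcases zmod_two_cases d with rfl | rfl <;>
    (ext i j; fin_cases i <;> fin_cases j <;>
      simp [exponentMatrix, signChar, Pauli.matrix, CharTwo.add_self_eq_zero, Matrix.mul_apply,
        Fin.sum_univ_two])

lemma trace_exponentMatrix (v : PauliExponents) :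
    (exponentMatrix v).trace = if v = 0 then 2 else 0 := by
  obtain ⟨a, b⟩ := v
  rcases zmod_two_cases a with rfl | rfl <;> rcases zmod_two_cases b with rfl | rfl <;>
    simp [exponentMatrix, Pauli.matrix, Matrix.trace, Fin.sum_univ_two]

variable {L : ℕ} [NeZero L]

/-- The operator `⨂_p X ^ x_p * Z ^ z_p` of a Pauli string. -/
noncomputable def stringOp (B : PauliString (ZMod L)) : Operator L :=
  Matrix.of fun s t => ∏ p, exponentMatrix (B p) (s p) (t p)

lemma sum_prod_apply_eq (f : Site L → Fin 2 → ℂ) :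
    ∑ u : Site L → Fin 2, ∏ p, f p (u p) = ∏ p, ∑ a, f p a := by
  rw [Finset.prod_univ_sum, Fintype.piFinset_univ]

lemma stringOp_mul (A B : PauliString (ZMod L)) :
    stringOp A * stringOp B = signChar (∑ p, (A p).2 * (B p).1) • stringOp (A + B) := by
  ext s t
  rw [Matrix.mul_apply, Matrix.smul_apply]
  simp only [stringOp, Matrix.of_apply, ← Finset.prod_mul_distrib]
  rw [sum_prod_apply_eq (fun p a => exponentMatrix (A p) (s p) a * exponentMatrix (B p) a (t p)),
    signChar_sum, smul_eq_mul, ← Finset.prod_mul_distrib]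
  refine Finset.prod_congr rfl fun p _ => ?_
  rw [← Matrix.mul_apply, exponentMatrix_mul, Matrix.smul_apply, smul_eq_mul, Finsupp.add_apply]

lemma trace_stringOp (B : PauliString (ZMod L)) :
    (stringOp B).trace = if B = 0 then 2 ^ Fintype.card (Site L) else 0 := by
  have : (stringOp B).trace = ∏ p, (exponentMatrix (B p)).trace := by
    simp only [Matrix.trace, stringOp, Matrix.of_apply, Matrix.diag_apply]
    exact sum_prod_apply_eq (fun p a => exponentMatrix (B p) a a)
  rw [this]
  split_ifs with h
  · subst h
    simp [trace_exponentMatrix]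
  · obtain ⟨p, hp⟩ := DFunLike.ne_iff.1 h
    refine Finset.prod_eq_zero (Finset.mem_univ p) ?_
    rw [trace_exponentMatrix]
    exact if_neg hp

noncomputable instance : Fintype (PauliString (ZMod L)) :=
  Fintype.ofEquiv _ Finsupp.equivFunOnFinite.symm

/-- Multiply by `stringOp C` and take the trace: only `B = C` gives a multiple of the identity, and
all other products are traceless. -/
lemma eq_zero_of_sum_stringOp {e : PauliString (ZMod L) → ℂ}
    (h : ∑ B, e B • stringOp B = 0) (C : PauliString (ZMod L)) : e C = 0 := by
  classical
  have h1 : ((∑ B, e B • stringOp B) * stringOp C).trace = 0 := by rw [h]; simp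
  rw [Finset.sum_mul, Matrix.trace_sum, Finset.sum_eq_single C] at h1
  · rw [Matrix.smul_mul, stringOp_mul, string_add_self, Matrix.trace_smul, Matrix.trace_smul,
      trace_stringOp, if_pos rfl, smul_eq_mul, smul_eq_mul] at h1
    exact (mul_eq_zero.1 h1).resolve_right (mul_ne_zero (signChar_ne_zero _) (by simp))
  · intro B _ hB
    rw [Matrix.smul_mul, stringOp_mul, Matrix.trace_smul, Matrix.trace_smul, trace_stringOp,
      if_neg, smul_zero, smul_zero]
    intro H
    refine hB ?_
    rw [← string_add_cancel B C, H, zero_add]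
  · simp

/-- The terms of the Hamiltonian, listed by their kind. -/
def termEquiv (C : Type*) :
    ((C × Fin 2) ⊕ C) ⊕ ((C × Fin 2) ⊕ (C × Fin 2)) ≃ Term C where
  toFun
    | .inl (.inl r) => .bond r
    | .inl (.inr c) => .rung c
    | .inr (.inl r) => .field r
    | .inr (.inr r) => .flip r
  invFun
    | .bond r => .inl (.inl r)
    | .rung c => .inl (.inr c)
    | .field r => .inr (.inl r)
    | .flip r => .inr (.inr r)
  left_inv := by rintro ((_ | _) | (_ | _)) <;> rfl
  right_inv := by rintro (_ | _ | _ | _) <;> rfl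

instance {C : Type*} [Fintype C] : Fintype (Term C) := Fintype.ofEquiv _ (termEquiv C)

lemma sum_term {C M : Type*} [Fintype C] [AddCommMonoid M] (f : Term C → M) :
    ∑ h, f h = (∑ r, f (.bond r) + ∑ c, f (.rung c)) + (∑ r, f (.field r) + ∑ r, f (.flip r)) := by
  rw [← (termEquiv C).sum_comp, Fintype.sum_sum_type, Fintype.sum_sum_type, Fintype.sum_sum_type]
  rfl

/-- The exponents of a Pauli operator. -/
def pauliEquiv : Pauli ≃ PauliExponents where
  toFun
    | .I => (0, 0)
    | .X => (1, 0)
    | .Y => (1, 1)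
    | .Z => (0, 1)
  invFun v := if v.1 = 0 then (if v.2 = 0 then .I else .Z) else (if v.2 = 0 then .X else .Y)
  left_inv := by rintro (_ | _) <;> decide
  right_inv := by decide

lemma pauliEquiv_eq_zero {P : Pauli} : pauliEquiv P = 0 ↔ P = Pauli.I := by
  cases P <;> simp [pauliEquiv]

/-- The phase relating a Pauli operator to the product `X ^ x * Z ^ z`. -/
noncomputable def Pauli.phase : Pauli → ℂ
  | .Y => Complex.I
  | _ => 1

lemma Pauli.phase_ne_zero (P : Pauli) : P.phase ≠ 0 := by
  cases P <;> simp [Pauli.phase]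

lemma Pauli.matrix_eq (P : Pauli) : P.matrix = P.phase • exponentMatrix (pauliEquiv P) := by
  cases P <;> ext i j <;> fin_cases i <;> fin_cases j <;>
    simp [Pauli.matrix, Pauli.phase, exponentMatrix, pauliEquiv]

/-- The Pauli string of a Pauli product. -/
noncomputable def toString : (Site L → Pauli) ≃ PauliString (ZMod L) :=
  (Equiv.arrowCongr (Equiv.refl _) pauliEquiv).trans Finsupp.equivFunOnFinite.symm

lemma toString_apply (A : Site L → Pauli) (r : Site L) : toString A r = pauliEquiv (A r) := rfl

lemma pauliProduct_eq (A : Site L → Pauli) :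
    pauliProduct A = (∏ p, (A p).phase) • stringOp (toString A) := by
  ext s t
  simp only [pauliProduct, stringOp, Matrix.of_apply, Matrix.smul_apply, smul_eq_mul,
    ← Finset.prod_mul_distrib, toString_apply]
  refine Finset.prod_congr rfl fun p _ => ?_
  rw [Pauli.matrix_eq, Matrix.smul_apply, smul_eq_mul]

lemma siteOp_eq (P : Pauli) (r : Site L) :
    siteOp P r = P.phase • stringOp (Finsupp.single r (pauliEquiv P)) := by
  rw [siteOp, pauliProduct_eq]
  congr 1
  · rw [Finset.prod_eq_single r]
    · simp
    · intro b _ hb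
      simp [hb, Pauli.phase]
    · simp
  · congr 1
    ext1 s
    rw [toString_apply, Finsupp.single_apply]
    by_cases h : r = s
    · subst h; simp
    · rw [if_neg h, Function.update_of_ne (Ne.symm h)]
      rfl

lemma siteOp_Z (r : Site L) : siteOp Pauli.Z r = stringOp (zString r) := by
  rw [siteOp_eq, show Pauli.Z.phase = 1 from rfl, one_smul]; rfl

lemma siteOp_X (r : Site L) : siteOp Pauli.X r = stringOp (xString r) := by
  rw [siteOp_eq, show Pauli.X.phase = 1 from rfl, one_smul]; rfl

lemma siteOp_Z_mul (r s : Site L) :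
    siteOp Pauli.Z r * siteOp Pauli.Z s = stringOp (zString r + zString s) := by
  rw [siteOp_Z, siteOp_Z, stringOp_mul]
  simp [signChar_zero]

/-- The couplings of the Hamiltonian, as complex numbers. -/
noncomputable def realCouplings (J₁ J₂ hx hz : ℝ) : Couplings := ⟨J₁, J₂, hx, hz⟩

lemma hamiltonian_eq (J₁ J₂ hx hz : ℝ) : hamiltonian L J₁ J₂ hx hz =
    ∑ h : Term (ZMod L), h.coeff (realCouplings J₁ J₂ hx hz) • stringOp h.string := by
  rw [sum_term, hamiltonian]
  simp only [siteOp_Z_mul]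
  simp only [Finset.sum_add_distrib, siteOp_X, siteOp_Z, Site.next, Term.coeff,
    Term.string, realCouplings]
  abel

/-- In the order `X ^ x * Z ^ z` a term made of `Z` acquires its sign when standing on the left, the
transverse field when standing on the right. This is why `weight` reverses the sign of `hx`. -/
lemma commutator_stringOp (g : Couplings) (A : PauliString (ZMod L)) (h : Term (ZMod L)) :
    h.coeff g • (stringOp A * stringOp h.string - stringOp h.string * stringOp A)
      = (if h.form A = 0 then 0 else 2 * h.weight g) • stringOp (A + h.string) := by
  rw [stringOp_mul, stringOp_mul, add_comm h.string A, ← sub_smul, smul_smul]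
  congr 1
  by_cases hf : h.form A = 0
  · rw [if_pos hf]
    cases h <;> simp only [Term.form] at hf <;>
      simp [Term.string, add_mul, Finset.sum_add_distrib, signChar_zero, hf]
  · rw [if_neg hf]
    have h2 : signChar (h.form A) = -1 := if_neg hf
    cases h <;> simp only [Term.form] at h2 <;>
      simp [Term.string, Term.coeff, Term.weight, add_mul, Finset.sum_add_distrib, signChar_zero,
        h2] <;> ring

/-- Expand the commutator, substitute `A = B + h` for each term `h`, and compare coefficients of the
linearly independent strings `B`. -/
lemma isSolution_of_commute {g : Couplings} {d : PauliString (ZMod L) → ℂ}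
    (hc : Commute (∑ A, d A • stringOp A)
      (∑ h : Term (ZMod L), h.coeff g • stringOp h.string)) :
    IsSolution g d := by
  have h0 : ∑ B, (2 * ∑ h, contribution g d B h) • stringOp B = 0 := by
    calc ∑ B, (2 * ∑ h, contribution g d B h) • stringOp B
        = ∑ h : Term (ZMod L), ∑ B, (2 * contribution g d B h) • stringOp B := by
          rw [Finset.sum_comm]
          refine Finset.sum_congr rfl fun B _ => ?_
          rw [Finset.mul_sum, Finset.sum_smul]
      _ = ∑ h : Term (ZMod L), ∑ A, d A • h.coeff g •
          (stringOp A * stringOp h.string - stringOp h.string * stringOp A) := by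
          refine Finset.sum_congr rfl fun h _ => ?_
          refine Fintype.sum_equiv (Equiv.addRight h.string) _ _ fun B => ?_
          rw [commutator_stringOp, smul_smul, contribution]
          simp only [Equiv.coe_addRight, string_add_cancel, Term.form_add_string]
          congr 1
          split_ifs <;> ring
      _ = 0 := by
          rw [Finset.sum_comm, ← sub_eq_zero_of_eq hc.eq, Finset.sum_mul_sum, Finset.sum_mul_sum,
            Finset.sum_comm (s := Finset.univ (α := Term (ZMod L))), ← Finset.sum_sub_distrib]
          refine Finset.sum_congr rfl fun A _ => ?_
          rw [← Finset.sum_sub_distrib]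
          refine Finset.sum_congr rfl fun h _ => ?_
          simp only [Matrix.smul_mul, Matrix.mul_smul, smul_sub]
          congr 1
          rw [smul_comm]
  intro B
  rw [finsum_eq_sum_of_fintype]
  have := eq_zero_of_sum_stringOp h0 B
  simpa using this

end Operators

/-! ### Lifting solutions from the ring to the infinite ladder. -/

section Lift

/-- The columns on which `B` acts nontrivially are among the `m` columns starting with `a`. -/
def InWindow (B : PauliString ℤ) (a : ℤ) (m : ℕ) : Prop :=
  ∀ r, B r ≠ 0 → a ≤ r.1 ∧ r.1 < a + m

/-- The columns on which `A` acts nontrivially are among the `m` consecutive columns starting with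
`a`. -/
def InArc {L : ℕ} (A : PauliString (ZMod L)) (a : ZMod L) (m : ℕ) : Prop :=
  ∀ r, A r ≠ 0 → ∃ i < m, r.1 = a + (i : ZMod L)

lemma InWindow.add {A B : PauliString ℤ} {a : ℤ} {m : ℕ} (hA : InWindow A a m)
    (hB : InWindow B a m) : InWindow (A + B) a m := by
  intro r hr
  rcases add_ne_zero_or (a := A r) (b := B r) hr with h | h
  exacts [hA r h, hB r h]

lemma InWindow.mono {A : PauliString ℤ} {a b : ℤ} {m m' : ℕ} (hA : InWindow A a m)
    (h1 : b ≤ a) (h2 : a + m ≤ b + m') : InWindow A b m' :=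
  fun r hr => ⟨h1.trans (hA r hr).1, (hA r hr).2.trans_le h2⟩

/-- The first column of a term. -/
def Term.first {C : Type*} : Term C → C
  | bond r => r.1
  | rung c => c
  | field r => r.1
  | flip r => r.1

/-- The last column of a term. -/
def Term.last {C : Type*} [Add C] [One C] : Term C → C
  | bond r => r.1 + 1
  | rung c => c
  | field r => r.1
  | flip r => r.1

lemma Term.first_le_last (h : Term ℤ) : h.first ≤ h.last ∧ h.last ≤ h.first + 1 := by
  cases h <;> simp [first, last]

lemma Term.inWindow_string (h : Term ℤ) {r : ℤ × Fin 2} (hr : h.string r ≠ 0) :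
    h.first ≤ r.1 ∧ r.1 ≤ h.last := by
  have hz : ∀ s : ℤ × Fin 2, zString s r ≠ 0 → r = s := fun s hs => by
    by_contra H
    exact hs (Finsupp.single_eq_of_ne H)
  cases h with
  | bond s =>
    rcases add_ne_zero_or (a := zString s r) (b := zString (s.1 + 1, s.2) r) hr with h | h
    · rw [hz _ h]; simp [first, last]
    · rw [hz _ h]; simp [first, last]
  | rung c =>
    rcases add_ne_zero_or (a := zString (c, 0) r) (b := zString (c, 1) r) hr with h | h
    · rw [hz _ h]; simp [first, last]
    · rw [hz _ h]; simp [first, last]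
  | field s => rw [hz _ hr]; simp [first, last]
  | flip s =>
    have : r = s := by
      by_contra H
      exact hr (Finsupp.single_eq_of_ne H)
    rw [this]; simp [first, last]

/-- A term that does not commute with `B` shares a site with `B`, which remains in the support of
the product. -/
lemma Term.exists_of_form_ne_zero {h : Term ℤ} {B : PauliString ℤ} (hf : h.form B ≠ 0) :
    ∃ r, h.first ≤ r.1 ∧ r.1 ≤ h.last ∧ B r ≠ 0 ∧ (B + h.string) r ≠ 0 := by
  have hx : ∀ r, (B r).1 ≠ 0 → (h.string r).1 = 0 → B r ≠ 0 ∧ (B + h.string) r ≠ 0 := by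
    intro r h1 h2
    refine ⟨fun H => h1 (by rw [H]; rfl), fun H => h1 ?_⟩
    have := congrArg Prod.fst H
    simpa [h2] using this
  have hz : ∀ r, (B r).2 ≠ 0 → (h.string r).2 = 0 → B r ≠ 0 ∧ (B + h.string) r ≠ 0 := by
    intro r h1 h2
    refine ⟨fun H => h1 (by rw [H]; rfl), fun H => h1 ?_⟩
    have := congrArg Prod.snd H
    simpa [h2] using this
  cases h with
  | bond s =>
    rcases add_ne_zero_or hf with h | h
    · exact ⟨s, by simp [first], by simp [last], hx s h (by simp [string])⟩
    · exact ⟨(s.1 + 1, s.2), by simp [first], by simp [last], hx _ h (by simp [string])⟩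
  | rung c =>
    rcases add_ne_zero_or hf with h | h
    · exact ⟨(c, 0), by simp [first], by simp [last], hx _ h (by simp [string])⟩
    · exact ⟨(c, 1), by simp [first], by simp [last], hx _ h (by simp [string])⟩
  | field s => exact ⟨s, by simp [first], by simp [last], hx s hf (by simp [string])⟩
  | flip s => exact ⟨s, by simp [first], by simp [last], hz s hf (by simp [string])⟩

variable {L : ℕ}

/-- The projection of the infinite ladder to the periodic ladder. -/
def projSite (L : ℕ) (r : ℤ × Fin 2) : ZMod L × Fin 2 := ((r.1 : ZMod L), r.2)

/-- The projection of strings to the periodic ladder. -/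
noncomputable def wrap (L : ℕ) (B : PauliString ℤ) : PauliString (ZMod L) :=
  B.mapDomain (projSite L)

/-- The projection of terms to the periodic ladder. -/
def wrapTerm (L : ℕ) : Term ℤ → Term (ZMod L)
  | .bond r => .bond (projSite L r)
  | .rung c => .rung (c : ZMod L)
  | .field r => .field (projSite L r)
  | .flip r => .flip (projSite L r)

lemma wrap_add (A B : PauliString ℤ) : wrap L (A + B) = wrap L A + wrap L B :=
  Finsupp.mapDomain_add

lemma wrap_string (h : Term ℤ) : wrap L h.string = (wrapTerm L h).string := by
  cases h <;> simp [wrap, wrapTerm, Term.string, zString, xString, Finsupp.mapDomain_add,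
    Finsupp.mapDomain_single, projSite]

lemma weight_wrapTerm (g : Couplings) (h : Term ℤ) : (wrapTerm L h).weight g = h.weight g := by
  cases h <;> rfl

lemma coeff_wrapTerm (g : Couplings) (h : Term ℤ) : (wrapTerm L h).coeff g = h.coeff g := by
  cases h <;> rfl

lemma projSite_injOn (a : ℤ) : Set.InjOn (projSite L) {r | a ≤ r.1 ∧ r.1 < a + L} := by
  rintro ⟨c, j⟩ ⟨h1, h2⟩ ⟨d, l⟩ ⟨h3, h4⟩ h
  simp only [projSite, Prod.mk.injEq] at h h1 h2 h3 h4
  obtain ⟨h, rfl⟩ := h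
  rw [ZMod.intCast_eq_intCast_iff_dvd_sub] at h
  have : d - c = 0 := Int.eq_zero_of_abs_lt_dvd h (by rw [abs_lt]; lia)
  rw [Prod.mk.injEq]
  exact ⟨by lia, rfl⟩

lemma wrap_apply {B : PauliString ℤ} {a : ℤ} (hB : InWindow B a L) {r : ℤ × Fin 2}
    (h1 : a ≤ r.1) (h2 : r.1 < a + L) : wrap L B (projSite L r) = B r :=
  Finsupp.mapDomain_apply' {r : ℤ × Fin 2 | a ≤ r.1 ∧ r.1 < a + L} B
    (fun s hs => hB s (Finsupp.mem_support_iff.1 hs)) (projSite_injOn a) ⟨h1, h2⟩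

open Classical in
/-- The coefficients on the infinite ladder that are induced by the coefficients `d` of an operator
on the periodic ladder whose terms extend over at most `k` columns. -/
noncomputable def unwrap (k : ℕ) (d : PauliString (ZMod L) → ℂ) (B : PauliString ℤ) : ℂ :=
  if ∃ a, InWindow B a k then d (wrap L B) else 0

variable {k : ℕ} {d : PauliString (ZMod L) → ℂ}

lemma unwrap_eq {B : PauliString ℤ} {a : ℤ} (h : InWindow B a k) :
    unwrap k d B = d (wrap L B) := if_pos ⟨a, h⟩

lemma exists_inWindow {B : PauliString ℤ} (h : unwrap k d B ≠ 0) : ∃ a, InWindow B a k := by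
  by_contra H
  exact h (if_neg H)

lemma unwrap_eq_zero {B : PauliString ℤ} {r s : ℤ × Fin 2} (hr : B r ≠ 0) (hs : B s ≠ 0)
    (hrs : s.1 = r.1 + k) : unwrap k d B = 0 := by
  by_contra H
  obtain ⟨a, ha⟩ := exists_inWindow H
  have h1 := ha r hr
  have h2 := ha s hs
  lia

/-- On the ring the two columns are `k` apart one way and `L - k ≥ k` the other, so no arc of `k`
columns contains both. -/
lemma wrap_eq_zero (hd : ∀ A, d A ≠ 0 → ∃ a, InArc A a k) (hkL : 2 * k ≤ L)
    {B : PauliString ℤ} {b : ℤ} (hB : InWindow B b L) {r s : ℤ × Fin 2} (hr : B r ≠ 0)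
    (hs : B s ≠ 0) (hrs : s.1 = r.1 + k) : d (wrap L B) = 0 := by
  by_contra H
  obtain ⟨a, ha⟩ := hd _ H
  obtain ⟨i, hi, h1⟩ := ha (projSite L r)
    (by rwa [wrap_apply hB (hB r hr).1 (hB r hr).2])
  obtain ⟨i', hi', h2⟩ := ha (projSite L s)
    (by rwa [wrap_apply hB (hB s hs).1 (hB s hs).2])
  simp only [projSite, hrs] at h1 h2
  push_cast at h2
  have h3 : (((i' : ℤ) : ZMod L)) = (((i : ℤ) + k : ℤ) : ZMod L) := by
    push_cast
    linear_combination h1 - h2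
  rw [ZMod.intCast_eq_intCast_iff_dvd_sub] at h3
  have := Int.le_of_dvd (by lia) h3
  lia

/-- A string fitting neither of the two subwindows of `k` columns meets the first and the last
column; these are `k` apart, so both sides vanish. -/
lemma unwrap_eq_of_succ (hd : ∀ A, d A ≠ 0 → ∃ a, InArc A a k) (hkL : 2 * k ≤ L) (hk : 2 ≤ k)
    {B : PauliString ℤ} {a : ℤ} (hB : InWindow B a (k + 1)) : unwrap k d B = d (wrap L B) := by
  by_cases h1 : InWindow B a k
  · exact unwrap_eq h1
  by_cases h2 : InWindow B (a + 1) k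
  · exact unwrap_eq h2
  unfold InWindow at h1 h2
  push Not at h1 h2
  obtain ⟨s, hs, hs'⟩ := h1
  obtain ⟨r, hr, hr'⟩ := h2
  have hs1 := hB s hs
  have hr1 := hB r hr
  have hrs : s.1 = r.1 + k := by push_cast at *; lia
  rw [unwrap_eq_zero hr hs hrs, wrap_eq_zero hd hkL
    (hB.mono le_rfl (by push_cast; lia)) hr hs hrs]

/-- If the product needs `k + 2` columns, the site that `h` shares with `B` survives in it, as does
a site at the far end of `B`. These are `k` columns apart, so both sides vanish. The hypothesis `2 ≤
k` ensures `k + 2 ≤ L`. -/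
lemma unwrap_add_string (hd : ∀ A, d A ≠ 0 → ∃ a, InArc A a k) (hkL : 2 * k ≤ L) (hk : 2 ≤ k)
    {B : PauliString ℤ} {a : ℤ} (hB : InWindow B a (k + 1)) {h : Term ℤ} (hf : h.form B ≠ 0) :
    unwrap k d (B + h.string) = d (wrap L (B + h.string)) := by
  obtain ⟨r, hr1, hr2, hr3, hr4⟩ := h.exists_of_form_ne_zero hf
  have hra := hB r hr3
  have hfl := h.first_le_last
  have hstr : ∀ b (m : ℕ), b ≤ h.first → h.last < b + m → InWindow h.string b m :=
    fun b m h1 h2 s hs => by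
      have := h.inWindow_string hs
      lia
  push_cast at hra
  by_cases h1 : a ≤ h.first
  · by_cases h2 : h.last ≤ a + k
    · exact unwrap_eq_of_succ hd hkL hk (hB.add (hstr a (k + 1) h1 (by push_cast; lia)))
    by_cases h3 : InWindow B (a + 1) k
    · exact unwrap_eq_of_succ hd hkL hk ((h3.mono le_rfl (by push_cast; lia)).add
        (hstr (a + 1) (k + 1) (by lia) (by push_cast; lia)))
    unfold InWindow at h3
    push Not at h3
    obtain ⟨s, hs, hs'⟩ := h3
    have hsa := hB s hs
    push_cast at hsa
    have hs0 : h.string s = 0 := by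
      by_contra H
      have := h.inWindow_string H
      lia
    have hs1 : (B + h.string) s ≠ 0 := by rwa [Finsupp.add_apply, hs0, add_zero]
    have hrs : r.1 = s.1 + k := by lia
    rw [unwrap_eq_zero hs1 hr4 hrs, wrap_eq_zero hd hkL
      ((hB.mono (b := a) (m' := L) le_rfl (by push_cast; lia)).add (hstr a L (by lia) (by lia)))
      hs1 hr4 hrs]
  · by_cases h3 : InWindow B a k
    · exact unwrap_eq_of_succ hd hkL hk ((h3.mono (b := a - 1) (by lia) (by push_cast; lia)).add
        (hstr (a - 1) (k + 1) (by lia) (by push_cast; lia)))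
    unfold InWindow at h3
    push Not at h3
    obtain ⟨s, hs, hs'⟩ := h3
    have hsa := hB s hs
    push_cast at hsa
    have hs0 : h.string s = 0 := by
      by_contra H
      have := h.inWindow_string H
      lia
    have hs1 : (B + h.string) s ≠ 0 := by rwa [Finsupp.add_apply, hs0, add_zero]
    have hrs : s.1 = r.1 + k := by lia
    rw [unwrap_eq_zero hr4 hs1 hrs, wrap_eq_zero hd hkL
      ((hB.mono (b := a - 1) (m' := L) (by lia) (by push_cast; lia)).add
        (hstr (a - 1) L (by lia) (by lia))) hr4 hs1 hrs]

/-- The representative of a column in the interval of length `L` that starts with `a`. -/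
def liftColumn (a : ℤ) (c : ZMod L) : ℤ := a + (c - (a : ZMod L)).val

lemma liftColumn_cast [NeZero L] (a : ℤ) (c : ZMod L) : ((liftColumn a c : ℤ) : ZMod L) = c := by
  simp [liftColumn]

lemma liftColumn_bounds [NeZero L] (a : ℤ) (c : ZMod L) :
    a ≤ liftColumn a c ∧ liftColumn a c < a + L := by
  have := ZMod.val_lt (c - (a : ZMod L))
  unfold liftColumn
  lia

lemma liftColumn_intCast [NeZero L] {a c : ℤ} (h1 : a ≤ c) (h2 : c < a + L) :
    liftColumn a (c : ZMod L) = c := by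
  have h3 := liftColumn_bounds (L := L) a c
  have h4 : ((liftColumn a (c : ZMod L), 0) : ℤ × Fin 2) = (c, 0) :=
    projSite_injOn (L := L) a h3 ⟨h1, h2⟩ (by simp [projSite, liftColumn_cast])
  exact congrArg Prod.fst h4

/-- The representative of a term whose first column is in the interval of length `L` that starts
with `a`. -/
def liftTerm (a : ℤ) : Term (ZMod L) → Term ℤ
  | .bond r => .bond (liftColumn a r.1, r.2)
  | .rung c => .rung (liftColumn a c)
  | .field r => .field (liftColumn a r.1, r.2)
  | .flip r => .flip (liftColumn a r.1, r.2)

lemma wrapTerm_liftTerm [NeZero L] (a : ℤ) (h : Term (ZMod L)) :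
    wrapTerm L (liftTerm a h) = h := by
  cases h <;> simp [wrapTerm, liftTerm, projSite, liftColumn_cast]

lemma liftTerm_wrapTerm [NeZero L] {a : ℤ} {h : Term ℤ} (h1 : a ≤ h.first)
    (h2 : h.first < a + L) : liftTerm a (wrapTerm L h) = h := by
  cases h <;> simp_all [wrapTerm, liftTerm, projSite, Term.first, liftColumn_intCast]

lemma first_liftTerm [NeZero L] (a : ℤ) (h : Term (ZMod L)) :
    a ≤ (liftTerm a h).first ∧ (liftTerm a h).first < a + L := by
  cases h <;> exact liftColumn_bounds a _

/-- The range of first columns starts at `a - 1` because a bond from there already touches `B`. The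
last bond reaches `a - 1 + L`, identified with `a - 1`, and `B` is trivial on both, so one of two
windows of `L` columns applies. -/
lemma form_wrapTerm {B : PauliString ℤ} {a : ℤ} (hB : InWindow B a (k + 1)) (hkL : k + 2 ≤ L)
    {h : Term ℤ} (h1 : a - 1 ≤ h.first) (h2 : h.first < a - 1 + L) :
    (wrapTerm L h).form (wrap L B) = h.form B := by
  have happ : ∀ r : ℤ × Fin 2, a - 1 ≤ r.1 → r.1 < a + L → wrap L B (projSite L r) = B r := by
    intro r hr1 hr2
    by_cases h3 : r.1 < a - 1 + L
    · exact wrap_apply (hB.mono (b := a - 1) (by lia) (by push_cast; lia)) hr1 h3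
    · exact wrap_apply (hB.mono (b := a) (by lia) (by push_cast; lia)) (by lia) hr2
  cases h with
  | bond r =>
    have e : ((projSite L r).1 + 1, (projSite L r).2) = projSite L (r.1 + 1, r.2) := by
      simp [projSite]
    simp only [Term.first] at h1 h2
    simp only [wrapTerm, Term.form]
    rw [e, happ r (by lia) (by lia), happ _ (by simp only; lia) (by simp only; lia)]
  | rung c =>
    simp only [Term.first] at h1 h2
    simp only [wrapTerm, Term.form]
    rw [← happ (c, 0) (by simp only; lia) (by simp only; lia),
      ← happ (c, 1) (by simp only; lia) (by simp only; lia)]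
    rfl
  | field r =>
    simp only [Term.first] at h1 h2
    simp only [wrapTerm, Term.form]
    rw [happ r (by lia) (by lia)]
  | flip r =>
    simp only [Term.first] at h1 h2
    simp only [wrapTerm, Term.form]
    rw [happ r (by lia) (by lia)]

lemma finsum_eq_of_injective {α β M : Type*} [AddCommMonoid M] {e : α → β}
    (he : Function.Injective e) {f : β → M} (hf : ∀ b, f b ≠ 0 → b ∈ Set.range e) :
    ∑ᶠ b, f b = ∑ᶠ a, f (e a) := by
  rw [← finsum_mem_range he, finsum_mem_def]
  refine finsum_congr fun b => ?_
  by_cases hb : b ∈ Set.range e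
  · rw [Set.indicator_of_mem hb]
  · rw [Set.indicator_of_notMem hb]
    by_contra H
    exact hb (hf b H)

/-- The commutation equations hold on the infinite ladder. -/
lemma IsSolution.unwrap [NeZero L] {g : Couplings} (hS : IsSolution g d)
    (hd : ∀ A, d A ≠ 0 → ∃ a, InArc A a k) (hkL : 2 * k ≤ L) (hk : 2 ≤ k) :
    IsSolution g (unwrap k d) := by
  intro B
  by_cases hB : ∃ a, InWindow B a (k + 1)
  · obtain ⟨a, ha⟩ := hB
    -- Every term on the ring has one lift with first column in the period from `a - 1`; all other
    -- terms of the infinite ladder commute with `B`.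
    rw [finsum_eq_of_injective (e := liftTerm (L := L) (a - 1))
      (Function.LeftInverse.injective (wrapTerm_liftTerm (a - 1))), ← hS (wrap L B)]
    · refine finsum_congr fun h => ?_
      obtain ⟨h1, h2⟩ := first_liftTerm (a - 1) h
      have e := form_wrapTerm ha (L := L) (by lia) h1 h2
      conv_rhs => rw [← wrapTerm_liftTerm (a - 1) h]
      unfold contribution
      rw [e, weight_wrapTerm, ← wrap_string, ← wrap_add]
      split_ifs with h0
      · rfl
      · rw [unwrap_add_string hd hkL hk ha h0]
    · intro h hh
      obtain ⟨r, hr1, hr2, hr3, -⟩ := Term.exists_of_form_ne_zero (contribution_ne_zero hh).1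
      have h1 := ha r hr3
      have h2 := h.first_le_last
      push_cast at h1
      exact ⟨wrapTerm L h, liftTerm_wrapTerm (by lia) (by lia)⟩
  -- A contributing term overlaps the product, which spans at most `k` columns, so it enlarges the
  -- window by at most one column. A wider `B` therefore has only zero summands.
  · rw [← finsum_zero (α := Term ℤ)]
    refine finsum_congr fun h => ?_
    by_contra H
    obtain ⟨h1, h2⟩ := contribution_ne_zero H
    obtain ⟨a, ha⟩ := exists_inWindow h2
    rw [← Term.form_add_string] at h1
    obtain ⟨r, hr1, hr2, hr3, -⟩ := Term.exists_of_form_ne_zero h1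
    have h3 := ha r hr3
    have h4 := h.first_le_last
    refine hB ⟨min a h.first, ?_⟩
    rw [← string_add_cancel B h.string]
    refine (ha.mono (by lia) (by push_cast; lia)).add fun s hs => ?_
    have := h.inWindow_string hs
    push_cast
    lia

/-- Columns `a` to `a + k - 1` occupy `2 * a` to `2 * (a + k - 1) + 1` in the order of the
generators; the length `2 * k - 1` is written in the shape that `LengthLE.one` takes. -/
lemma lengthLE_unwrap (d : PauliString (ZMod L) → ℂ) (hk : 1 ≤ k) :
    LengthLE (unwrap k d) ((2 * k - 2 : ℕ) + 1) := by
  intro B hB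
  obtain ⟨a, ha⟩ := exists_inWindow hB
  refine ⟨2 * a, fun r => ?_, fun r => ?_⟩ <;>
    refine ⟨fun h => ?_, fun h => ?_⟩ <;>
    · have := ha r (fun H => h (by rw [H]; rfl))
      lia

lemma exists_wrap_eq [NeZero L] (hkL : k ≤ L) {A : PauliString (ZMod L)} {a : ZMod L}
    (hA : InArc A a k) : ∃ B, InWindow B a.val k ∧ wrap L B = A := by
  classical
  refine ⟨A.mapDomain fun r => (liftColumn a.val r.1, r.2), fun s hs => ?_, ?_⟩
  · obtain ⟨r, hr, rfl⟩ := Finset.mem_image.1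
      (Finsupp.mapDomain_support (Finsupp.mem_support_iff.2 hs))
    obtain ⟨i, hi, h⟩ := hA r (Finsupp.mem_support_iff.1 hr)
    have : (r.1 - ((a.val : ℤ) : ZMod L)).val = i := by
      rw [h, Int.cast_natCast, ZMod.natCast_zmod_val, add_sub_cancel_left]
      exact ZMod.val_cast_of_lt (by lia)
    simp only [liftColumn, this]
    lia
  · rw [wrap, ← Finsupp.mapDomain_comp]
    convert Finsupp.mapDomain_id
    ext r
    · simp [projSite, liftColumn_cast]
    · rfl

/-- Solutions on the periodic ladder whose terms extend over at most `k` columns are multiples of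
the Hamiltonian, up to the coefficient of the identity. -/
theorem IsSolution.eq_smul_coeff [NeZero L] {g : Couplings} (hS : IsSolution g d)
    (hJ : g.J₁ ≠ 0) (hJ₂ : g.J₂ ≠ 0) (hh : g.hx ≠ 0)
    (hd : ∀ A, d A ≠ 0 → ∃ a, InArc A a k) (hkL : 2 * k ≤ L) (hk : 2 ≤ k) :
    (∃ β : ℂ, ∀ h : Term (ZMod L), d h.string = β * h.coeff g) ∧
      ∀ A, A ≠ 0 → d A ≠ 0 → ∃ h : Term (ZMod L), A = h.string := by
  have hS' := hS.unwrap hd hkL hk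
  have h1 := LengthLE.one hS' hJ hJ₂ hh _ (lengthLE_unwrap d (by lia))
  refine ⟨?_, fun A hA hdA => ?_⟩
  · obtain ⟨β, hβ⟩ := LengthLE.eq_smul_coeff hS' hJ hJ₂ hh h1
    refine ⟨β, fun h => ?_⟩
    have h2 := hβ (liftTerm 0 h)
    rwa [unwrap_eq (a := (liftTerm 0 h).first), wrap_string, ← coeff_wrapTerm (L := L),
      wrapTerm_liftTerm] at h2
    intro r hr
    have h3 := (liftTerm 0 h).inWindow_string hr
    have h4 := (liftTerm 0 h).first_le_last
    lia
  · obtain ⟨a, ha⟩ := hd A hdA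
    obtain ⟨B, hB, rfl⟩ := exists_wrap_eq (by lia) ha
    rw [← unwrap_eq (k := k) (d := d) hB] at hdA
    obtain ⟨h, rfl⟩ := h1.eq_string hS' hJ hh (by rintro rfl; exact hA Finsupp.mapDomain_zero) hdA
    exact ⟨wrapTerm L h, wrap_string h⟩

end Lift

/-! ### Range one, directly on the ring. -/

section OneColumn

variable {L : ℕ}

lemma zmod_add_one_ne (hL : 2 ≤ L) (c : ZMod L) : c + 1 ≠ c := by
  have : Fact (1 < L) := ⟨hL⟩
  simp

/-- A solution whose terms act on a single column is a multiple of the identity. -/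
lemma IsSolution.eq_zero_of_one_column {g : Couplings} {d : PauliString (ZMod L) → ℂ}
    (hS : IsSolution g d) (hJ : g.J₁ ≠ 0) (hh : g.hx ≠ 0) (hL : 2 ≤ L)
    (hd : ∀ A, d A ≠ 0 → ∃ a, InArc A a 1) {A : PauliString (ZMod L)} (hA : A ≠ 0) : d A = 0 := by
  classical
  have hne := zmod_add_one_ne hL
  have h10 : (1 : ZMod L) ≠ 0 := by simpa using hne 0
  have hcol : ∀ A, d A ≠ 0 → ∃ c, ∀ r, A r ≠ 0 → r.1 = c := by
    intro A hA
    obtain ⟨a, ha⟩ := hd A hA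
    refine ⟨a, fun r hr => ?_⟩
    obtain ⟨i, hi, h⟩ := ha r hr
    obtain rfl : i = 0 := by lia
    simpa using h
  have hfst : ∀ A, d A ≠ 0 → ∀ r, (A r).1 = 0 := by
    intro A hA
    rintro ⟨c, j⟩
    by_contra hx
    obtain ⟨c', hc'⟩ := hcol A hA
    have hAc : ∀ r, r.1 ≠ c → A r = 0 := by
      intro r hr
      by_contra H
      exact hr ((hc' r H).trans (hc' (c, j) fun H => hx (by rw [H]; rfl)).symm)
    -- The bond adds a `Z` in column `c + 1`. A term leading back to one column must clear it while
    -- failing to commute with `B`, so it is a bond on leg `j` at that site.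
    set B := A + (Term.bond (c, j)).string with hB
    have hBx : ∀ r, (B r).1 = (A r).1 := by
      intro r
      simp [hB, Term.string]
    have hB1 : ∀ l, B (c + 1, l) = (0, if j = l then 1 else 0) := by
      intro l
      rw [hB, Finsupp.add_apply, hAc _ (hne c), zero_add]
      ext
      · simp [Term.string]
      · simp [Term.string, h10]
    have hx0 : ∀ d l, d ≠ c → (B (d, l)).1 = 0 := fun d l hd => by
      rw [hBx, hAc _ hd]; rfl
    have key := hS.sum_eq_zero B {Term.bond (c, j), Term.bond (c + 1, j)} (fun h h1 h2 => by
      obtain ⟨b, hb⟩ := hcol _ h2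
      by_cases hc : (B (c, j)).1 + (h.string (c, j)).1 = 0
      · have h3 : (h.string (c, j)).1 ≠ 0 := fun H => by
          rw [H, add_zero, hBx] at hc; exact hx hc
        cases h with
        | flip r =>
          obtain rfl : r = (c, j) := by
            by_contra H
            simp [Term.string, H] at h3
          have e1 : c = b := hb (c, j) fun H => h1 (by
            have := congrArg Prod.snd H
            simpa [Term.string, Term.form] using this)
          have e2 : c + 1 = b := hb (c + 1, j) fun H => by
            have := congrArg Prod.snd H
            simp [Term.string, hB1] at this
          exact absurd (e2.trans e1.symm) (hne c)
        | _ => simp [Term.string] at h3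
      · have e1 : c = b := hb (c, j) fun H => hc (congrArg Prod.fst H)
        have e2 : (B + h.string) (c + 1, j) = 0 := by
          by_contra H
          exact hne c ((hb _ H).trans e1.symm)
        have h3 : (h.string (c + 1, j)).2 ≠ 0 := fun H => by
          have := congrArg Prod.snd e2
          simp [H, hB1] at this
        rw [Finset.mem_insert, Finset.mem_singleton]
        cases h with
        | bond r =>
          rcases add_ne_zero_or h3 with h4 | h4
          · right
            congr 1
            by_contra H
            simp [H] at h4
          · left
            congr 1
            have h5 : (r.1 + 1, r.2) = (c + 1, j) := by
              by_contra H
              exact h4 (by simp only [zString_snd]; rw [if_neg H])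
            rw [Prod.mk.injEq] at h5
            exact Prod.ext (add_right_cancel h5.1) h5.2
        | rung b =>
          have : b = c + 1 := by
            by_contra H
            simp [Term.string, H] at h3
          exact absurd (by simp [Term.form, this, hx0 _ _ (hne c)]) h1
        | field r =>
          have : r = (c + 1, j) := by
            by_contra H
            simp [Term.string, H] at h3
          exact absurd (by simp [Term.form, this, hx0 _ _ (hne c)]) h1
        | flip r => simp [Term.string] at h3)
    have hneb : (Term.bond (c, j) : Term (ZMod L)) ≠ Term.bond (c + 1, j) := by
      simpa using (hne c).symm
    have hf : (Term.bond (c, j)).form B ≠ 0 := by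
      simp only [Term.form]
      rw [hx0 _ _ (hne c), add_zero, hBx]
      exact hx
    rw [Finset.sum_pair hneb, contribution_eq hf, hB, string_add_cancel, ← hB] at key
    -- For `L = 2` both bonds have the same string; their contributions then add up instead of
    -- cancelling.
    by_cases h2 : c + 1 + 1 = c
    · have e : (Term.bond (c + 1, j)).string = (Term.bond (c, j)).string := by
        simp only [Term.string, h2]
        rw [add_comm]
      rw [contribution_eq, e, hB, string_add_cancel] at key
      · simp only [Term.weight] at key
        have : g.J₁ * d A = 0 := by linear_combination key / 2
        exact mul_ne_zero hJ hA this
      · simp only [Term.form]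
        rw [hx0 _ _ (hne c), zero_add, h2, hBx]
        exact hx
    · have e : (Term.bond (c + 1, j)).form B = 0 := by
        simp only [Term.form]
        rw [hx0 _ _ (hne c), hx0 _ _ h2, add_zero]
      rw [contribution, if_pos e, add_zero] at key
      exact mul_ne_zero hJ hA key
  by_contra hdA
  obtain ⟨r, hr⟩ := DFunLike.ne_iff.1 hA
  have hz : (A r).2 ≠ 0 := fun H => hr (Prod.ext (hfst A hdA r) H)
  -- Now all remaining strings consist of `Z`, so the `X` created at `r` must be removed, which only
  -- the same transverse field does.
  have key := hS.sum_eq_zero (A + (Term.flip r).string) {Term.flip r} (fun h h1 h2 => by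
    have h3 := hfst _ h2 r
    rw [Finset.mem_singleton]
    simp only [Term.string, Finsupp.add_apply, Prod.fst_add, hfst A hdA, xString_fst, if_true,
      zero_add] at h3
    cases h with
    | flip s =>
      congr 1
      by_contra H
      simp [H] at h3
    | _ => simp at h3)
  rw [Finset.sum_singleton, contribution_eq, string_add_cancel] at key
  · exact mul_ne_zero (neg_ne_zero.2 hh) hdA key
  · rw [Term.form_add_string]
    exact hz

end OneColumn

/-! ### Reassembling the Hamiltonian, and the theorem. -/

section Main

variable {L : ℕ}

lemma string_ne_zero (hL : 2 ≤ L) (h : Term (ZMod L)) : h.string ≠ 0 := by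
  have hne := zmod_add_one_ne hL
  intro H
  cases h with
  | bond r => simpa [Term.string, Prod.ext_iff, hne] using congrArg Prod.snd (DFunLike.congr_fun H r)
  | rung c => simpa [Term.string] using congrArg Prod.snd (DFunLike.congr_fun H (c, 0))
  | field r => simpa [Term.string] using congrArg Prod.snd (DFunLike.congr_fun H r)
  | flip r => simpa [Term.string] using congrArg Prod.fst (DFunLike.congr_fun H r)

/-- Terms are told apart by the supports of their `Z` and `X` parts. For `L = 2` the two bonds on a
leg would coincide. -/
lemma string_injective (hL : 3 ≤ L) : Function.Injective (Term.string (C := ZMod L)) := by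
  have h1 := zmod_add_one_ne (L := L) (by lia)
  have h2 : ∀ c : ZMod L, c + 1 + 1 ≠ c := by
    intro c H
    have h3 : ((2 : ℕ) : ZMod L) = 0 := by
      push_cast
      linear_combination H
    rw [ZMod.natCast_eq_zero_iff] at h3
    exact absurd (Nat.le_of_dvd (by lia) h3) (by lia)
  have hb : ∀ (r s : Site L), ((Term.bond r).string s).2 ≠ 0 ↔ s = r ∨ s = (r.1 + 1, r.2) := by
    rintro ⟨c, j⟩ ⟨b, l⟩
    simp only [Term.string, Finsupp.add_apply, Prod.snd_add, zString_snd, Prod.mk.injEq]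
    have := h1 c
    by_cases hj : j = l <;> by_cases hc : c = b <;> by_cases hc' : c + 1 = b <;>
      simp_all [eq_comm]
  have hr : ∀ (c : ZMod L) (s : Site L), ((Term.rung c).string s).2 ≠ 0 ↔ s.1 = c := by
    rintro c ⟨b, l⟩
    fin_cases l <;> simp [Term.string, eq_comm]
  have hf : ∀ (r s : Site L), ((Term.field r).string s).2 ≠ 0 ↔ s = r := by
    intro r s
    simp [Term.string, eq_comm]
  have hX : ∀ (r s : Site L), ((Term.flip r).string s).2 ≠ 0 ↔ False := by
    intro r s
    simp [Term.string]
  intro h h' e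
  have ez : ∀ s, (h.string s).2 ≠ 0 ↔ (h'.string s).2 ≠ 0 := fun s => by rw [e]
  cases h with
  | bond r =>
    obtain ⟨c, j⟩ := r
    have a := ez (c, j)
    have b := ez (c + 1, j)
    cases h' with
    | bond s =>
      simp only [hb, true_or, true_iff, or_true] at a b
      rcases a with a | a
      · rw [a]
      · rcases b with b | b
        · obtain ⟨d, l⟩ := s
          simp only [Prod.mk.injEq] at a b
          exact absurd (by rw [← b.1] at a; exact a.1.symm) (h2 c)
        · rw [← a, Prod.mk.injEq] at b
          exact absurd b.1 (h1 c)
    | rung s =>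
      simp only [hb, hr, true_or, true_iff, or_true] at a b
      exact absurd (b.trans a.symm) (h1 c)
    | field s =>
      simp only [hb, hf, true_or, true_iff, or_true] at a b
      rw [← a, Prod.mk.injEq] at b
      exact absurd b.1 (h1 c)
    | flip s => simp [hb, hX] at a
  | rung c =>
    have a := ez (c, 0)
    have b := ez (c, 1)
    cases h' with
    | bond s =>
      have a' := ez s
      have b' := ez (s.1 + 1, s.2)
      simp only [hb, hr, true_or, iff_true, or_true] at a' b'
      exact absurd (b'.trans a'.symm) (h1 _)
    | rung s =>
      simp only [hr, true_iff] at a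
      rw [a]
    | field s =>
      simp only [hr, hf, true_iff] at a b
      rw [← a] at b
      simp at b
    | flip s => simp [hr, hX] at a
  | field r =>
    have a := ez r
    cases h' with
    | bond s =>
      have a' := ez s
      have b' := ez (s.1 + 1, s.2)
      simp only [hb, hf, true_or, iff_true, or_true] at a' b'
      rw [← a'] at b'
      exact absurd (congrArg Prod.fst b') (h1 _)
    | rung s =>
      have a' := ez (s, 0)
      have b' := ez (s, 1)
      simp only [hr, hf, iff_true] at a' b'
      rw [← a'] at b'
      simp at b'
    | field s =>
      simp only [hf, true_iff] at a
      rw [a]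
    | flip s => simp [hf, hX] at a
  | flip r =>
    cases h' with
    | flip s =>
      have := congrArg Prod.fst (DFunLike.congr_fun e r)
      by_contra H
      have H' : s ≠ r := fun h => H (by rw [h])
      simp [Term.string, H'] at this
    | bond s => have a := ez s; simp [hb, hX] at a
    | rung s => have a := ez (s, 0); simp [hr, hX] at a
    | field s => have a := ez s; simp [hf, hX] at a

lemma Term.first_or_last (h : Term (ZMod L)) {r : Site L} (hr : h.string r ≠ 0) :
    r.1 = h.first ∨ r.1 = h.first + 1 := by
  have hz : ∀ s : Site L, zString s r ≠ 0 → r = s := fun s hs => by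
    by_contra H
    exact hs (Finsupp.single_eq_of_ne H)
  cases h with
  | bond s =>
    rcases add_ne_zero_or (a := zString s r) (b := zString (s.1 + 1, s.2) r) hr with h | h
    · exact Or.inl (by rw [hz _ h]; rfl)
    · exact Or.inr (by rw [hz _ h]; rfl)
  | rung c =>
    rcases add_ne_zero_or (a := zString (c, 0) r) (b := zString (c, 1) r) hr with h | h
    · exact Or.inl (by rw [hz _ h]; rfl)
    · exact Or.inl (by rw [hz _ h]; rfl)
  | field s => exact Or.inl (by rw [hz _ hr]; rfl)
  | flip s =>
    have : r = s := by
      by_contra H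
      exact hr (Finsupp.single_eq_of_ne H)
    exact Or.inl (by rw [this]; rfl)

variable [NeZero L]

lemma support_subset_rectangle (A : Site L → Pauli) : support A ⊆ rectangle (0, 0) L 2 := by
  rintro ⟨c, j⟩ -
  refine ⟨⟨c.val, ZMod.val_lt c, by simp⟩, ⟨j, j.2, by simp⟩⟩

lemma inArc_of_suppLength {A : Site L → Pauli} {k : ℕ} (h : suppLength₁ A ≤ k) :
    ∃ a, InArc (toString A) a k := by
  have hne : {ℓ₁ | ∃ (r : Site L) (ℓ₂ : ℕ), support A ⊆ rectangle r ℓ₁ ℓ₂}.Nonempty :=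
    ⟨L, _, _, support_subset_rectangle A⟩
  obtain ⟨r, ℓ₂, hr⟩ := Nat.sInf_mem hne
  refine ⟨r.1, fun s hs => ?_⟩
  obtain ⟨⟨i, hi, h1⟩, -⟩ := hr (a := s) fun H => hs (pauliEquiv_eq_zero.2 H)
  exact ⟨i, hi.trans_le h, h1⟩

lemma suppLength_le_two {A : Site L → Pauli} {h : Term (ZMod L)} (hA : toString A = h.string) :
    suppLength₁ A ≤ 2 := by
  refine Nat.sInf_le ⟨(h.first, 0), 2, fun r hr => ⟨?_, r.2, r.2.2, by simp⟩⟩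
  have h1 : h.string r ≠ 0 := by
    rw [← hA]
    exact fun H => hr (pauliEquiv_eq_zero.1 H)
  rcases h.first_or_last h1 with h2 | h2
  · exact ⟨0, by lia, by simpa using h2⟩
  · exact ⟨1, by lia, by simpa using h2⟩

lemma suppLength_eq_zero {A : Site L → Pauli} (hA : toString A = 0) : suppLength₁ A = 0 := by
  refine Nat.le_zero.1 (Nat.sInf_le ⟨(0, 0), 0, fun r hr => absurd ?_ hr⟩)
  exact pauliEquiv_eq_zero.1 (by rw [← toString_apply, hA]; rfl)

lemma stringOp_zero : stringOp (0 : PauliString (ZMod L)) = 1 := by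
  ext s t
  simp only [stringOp, exponentMatrix, Matrix.of_apply, Finsupp.coe_zero, Pi.zero_apply,
    Prod.fst_zero, Prod.snd_zero, if_true, mul_one]
  by_cases h : s = t
  · subst h; simp
  · rw [Matrix.one_apply_ne h]
    obtain ⟨p, hp⟩ := Function.ne_iff.1 h
    exact Finset.prod_eq_zero (Finset.mem_univ p) (Matrix.one_apply_ne hp)

/-- The coefficients of an operator in terms of Pauli strings. -/
noncomputable def stringCoeff (c : (Site L → Pauli) → ℂ) (B : PauliString (ZMod L)) : ℂ :=
  c (toString.symm B) * ∏ p, (toString.symm B p).phase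

lemma stringCoeff_toString (c : (Site L → Pauli) → ℂ) (A : Site L → Pauli) :
    stringCoeff c (toString A) = c A * ∏ p, (A p).phase := by
  simp [stringCoeff]

lemma stringCoeff_ne_zero {c : (Site L → Pauli) → ℂ} {A : Site L → Pauli} :
    stringCoeff c (toString A) ≠ 0 ↔ c A ≠ 0 := by
  rw [stringCoeff_toString]
  have : ∏ p, (A p).phase ≠ 0 := Finset.prod_ne_zero_iff.2 fun p _ => Pauli.phase_ne_zero _
  simp [this]

lemma sum_pauliProduct (c : (Site L → Pauli) → ℂ) :
    ∑ A, c A • pauliProduct A = ∑ B, stringCoeff c B • stringOp B := by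
  rw [← toString.sum_comp]
  refine Finset.sum_congr rfl fun A _ => ?_
  rw [stringCoeff_toString, pauliProduct_eq, smul_smul]

lemma sum_stringOp_eq (hL : 3 ≤ L) {g : Couplings} {d : PauliString (ZMod L) → ℂ} {β : ℂ}
    (hβ : ∀ h : Term (ZMod L), d h.string = β * h.coeff g)
    (hd : ∀ A, A ≠ 0 → d A ≠ 0 → ∃ h : Term (ZMod L), A = h.string) :
    ∑ B, d B • stringOp B
      = β • (∑ h : Term (ZMod L), h.coeff g • stringOp h.string) + d 0 • 1 := by
  classical
  have h0 : (0 : PauliString (ZMod L)) ∉ Finset.univ.image (Term.string (C := ZMod L)) := by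
    simp only [Finset.mem_image, Finset.mem_univ, true_and, not_exists]
    exact string_ne_zero (by lia)
  rw [← Finset.sum_subset (Finset.subset_univ
    (insert 0 (Finset.univ.image (Term.string (C := ZMod L)))))]
  · rw [Finset.sum_insert h0, Finset.sum_image (string_injective hL).injOn, stringOp_zero,
      add_comm, Finset.smul_sum]
    simp only [hβ, smul_smul]
  · intro B _ hB
    rw [Finset.mem_insert, not_or] at hB
    have : d B = 0 := by
      by_contra H
      obtain ⟨h, rfl⟩ := hd B hB.1 H
      exact hB.2 (Finset.mem_image_of_mem _ (Finset.mem_univ h))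
    rw [this, zero_smul]

/-- The structure of a conserved quantity whose terms extend over at most `k` columns. -/
lemma IsLocalConserved.exists_coeff {J₁ J₂ hx hz : ℝ} {k : ℕ} {Q : Operator L}
    (hQ : IsLocalConserved (hamiltonian L J₁ J₂ hx hz) k Q) :
    ∃ c : (Site L → Pauli) → ℂ, Q = ∑ B, stringCoeff c B • stringOp B ∧
      IsSolution (realCouplings J₁ J₂ hx hz) (stringCoeff c) ∧
      (∀ B, stringCoeff c B ≠ 0 → ∃ a, InArc B a k) ∧ ∃ A, c A ≠ 0 ∧ suppLength₁ A = k := by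
  obtain ⟨hc, c, hQ, h1⟩ : Commute Q (hamiltonian L J₁ J₂ hx hz) ∧ ∃ c : (Site L → Pauli) → ℂ,
      Q = ∑ A, c A • pauliProduct A ∧
      IsGreatest {ℓ₁ | ∃ A, c A ≠ 0 ∧ suppLength₁ A = ℓ₁} k := by
    rcases hQ with ⟨hc, c, hQ, h1, -⟩ | ⟨hc, c, hQ, h1, -⟩ <;> exact ⟨hc, c, hQ, h1⟩
  rw [sum_pauliProduct] at hQ
  refine ⟨c, hQ, isSolution_of_commute ?_, fun B hB => ?_, h1.1⟩
  · rwa [← hQ, ← hamiltonian_eq]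
  · obtain ⟨A, rfl⟩ := toString.surjective B
    exact inArc_of_suppLength (h1.2 ⟨A, stringCoeff_ne_zero.1 hB, rfl⟩)

end Main

end IsingLadder

theorem mainTheorem6 (L : ℕ) [NeZero L] (J₁ J₂ hx hz : ℝ)
    (hJ₁ : J₁ ≠ 0) (hJ₂ : J₂ ≠ 0) (hhx : hx ≠ 0)
    (k : ℕ) (hk : 1 ≤ k) (hkL : 2 * k ≤ L) :
    (3 ≤ k →
      ¬ ∃ Q : IsingLadder.Operator L,
        IsingLadder.IsLocalConserved (IsingLadder.hamiltonian L J₁ J₂ hx hz) k Q) ∧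
    (k ≤ 2 →
      ∀ Q : IsingLadder.Operator L,
        IsingLadder.IsLocalConserved (IsingLadder.hamiltonian L J₁ J₂ hx hz) k Q →
          (∃ a b : ℂ, Q = a • IsingLadder.hamiltonian L J₁ J₂ hx hz + b • 1) ∧
          IsingLadder.IsLocalConserved (IsingLadder.hamiltonian L J₁ J₂ hx hz) 2 Q) := by
  have hJ₁' : (IsingLadder.realCouplings J₁ J₂ hx hz).J₁ ≠ 0 := Complex.ofReal_ne_zero.2 hJ₁
  have hJ₂' : (IsingLadder.realCouplings J₁ J₂ hx hz).J₂ ≠ 0 := Complex.ofReal_ne_zero.2 hJ₂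
  have hhx' : (IsingLadder.realCouplings J₁ J₂ hx hz).hx ≠ 0 := Complex.ofReal_ne_zero.2 hhx
  refine ⟨?_, fun hk2 Q hQ => ?_⟩
  · rintro hk3 ⟨Q, hQ⟩
    obtain ⟨c, -, hS, hd, A, hA, hAk⟩ := hQ.exists_coeff
    obtain ⟨-, h⟩ := hS.eq_smul_coeff hJ₁' hJ₂' hhx' hd hkL (by lia)
    -- The product `A` attains length `k ≥ 3`, but the identity has length zero and a term of `H` at
    -- most two.
    by_cases h0 : IsingLadder.toString A = 0
    · rw [IsingLadder.suppLength_eq_zero h0] at hAk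
      lia
    · obtain ⟨t, ht⟩ := h _ h0 (IsingLadder.stringCoeff_ne_zero.2 hA)
      have := IsingLadder.suppLength_le_two ht
      lia
  · obtain ⟨c, hQc, hS, hd, A, hA, hAk⟩ := hQ.exists_coeff
    obtain rfl | rfl : k = 1 ∨ k = 2 := by lia
    -- A `1`-local conserved quantity does not exist, so `2`-locality of `Q` has content only for `k
    -- = 2`, where it is the hypothesis.
    · exfalso
      have h0 : IsingLadder.toString A ≠ 0 := fun h0 => by
        rw [IsingLadder.suppLength_eq_zero h0] at hAk
        lia
      exact IsingLadder.stringCoeff_ne_zero.2 hA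
        (hS.eq_zero_of_one_column hJ₁' hhx' (by lia) hd h0)
    · obtain ⟨⟨β, hβ⟩, h⟩ := hS.eq_smul_coeff hJ₁' hJ₂' hhx' hd hkL le_rfl
      refine ⟨⟨β, IsingLadder.stringCoeff c 0, ?_⟩, hQ⟩
      rw [hQc, IsingLadder.hamiltonian_eq]
      exact IsingLadder.sum_stringOp_eq (by lia) hβ h
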